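/- Let $0<\delta\le 1$ and let $z,h:\mathbb R\to\mathbb R^2$ be curves of class $C^{2,\delta}$ that are horizontally periodic, $z(\alpha+2\pi)=z(\alpha)+(2\pi,0)$ and $h(\alpha+2\pi)=h(\alpha)+(2\pi,0)$. Put $$\mathcal F(z)(\alpha,\beta)=\frac{|\beta|^2}{|z(\alpha)-z(\alpha-\beta)|^2}\ (\beta\ne0),\qquad \mathcal F(z)(\alpha,0)=\frac1{|\partial_\alpha z(\alpha)|^2},\qquad d(z,h)(\alpha,\beta)=\frac1{|z(\alpha)-h(\alpha-\beta)|^2}$$ (with value $+\infty$ where a denominator vanishes), let $\|\cdot\|_{L^\infty}$ be the supremum over $\alpha,\beta\in\mathbb R$, and let $$\|z\|_{C^{2,\delta}}=\sup_{[-\pi,\pi]}|z|+\sup|\partial_\alpha z|+\sup|\partial^2_\alpha z|+\sup_{\alpha\ne\beta}\frac{|\partial_\alpha^2z(\alpha)-\partial_\alpha^2z(\beta)|}{|\alpha-\beta|^\delta}.$$ With $(x_1,x_2)^\perp=(-x_2,x_1)$, for curves $x,y\in\{z,h\}$ and a $2\pi$-periodic $u\in L^2(\mathbb T)$, $\mathbb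 T=\mathbb R/2\pi\mathbb Z$, let $$2BR(u,y)_x(\alpha)\cdot\partial_\alpha x(\alpha)=\frac1\pi\,PV\!\int_{\mathbb R}\frac{(x(\alpha)-y(\alpha-\beta))^\perp\cdot\partial_\alpha x(\alpha)}{|x(\alpha)-y(\alpha-\beta)|^2}\,u(\alpha-\beta)\,d\beta ,$$ where $PV\int_{\mathbb R}$ is the limit of the integral over $\varepsilon<|\beta|<R$ as $\varepsilon\to0^+$, $R\to\infty$. Let $T_1u=2BR(u,z)_z\cdot\partial_\alpha z$, $T_2u=2BR(u,h)_z\cdot\partial_\alpha z$, $T_3u=2BR(u,z)_h\cdot\partial_\alpha h$, $T_4u=2BR(u,h)_h\cdot\partial_\alpha h$ and $\mathcal T(u,v)=(T_1u+T_2v,\;T_3u+T_4v)$. Pairs carry the norm $\|(u,v)\|=\|u\|+\|v\|$. Suppose that $\|\mathcal F(z)\|_{L^\infty}<\infty$, $\|\mathcal F(h)\|_{L^\infty}<\infty$ and $\|d(z,h)\|_{L^\infty}<\infty$. Then the principal values exist for every $u\in L^2(\mathbb T)$ and every $\alpha$, the operator $\mathcal T:L^2(\mathbb T)\times L^2(\mathbb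 T)\to H^1(\mathbb T)\times H^1(\mathbb T)$ is well defined, bounded and compact, and $$\|\mathcal T\|_{L^2\times L^2\to H^1\times H^1}\le C\,\|\mathcal F(z)\|_{L^\infty}^2\,\max\{1,\|d(z,h)\|_{L^\infty}\}^2\,\|z\|_{C^{2,\delta}}^4 ,$$ where $C$ depends only on $\delta$ and on the fixed curve $h$, not on $z$. In particular $\|\mathcal T\|\le C\|\mathcal F(z)\|_{L^\infty}^2\|d(z,h)\|_{L^\infty}^2\|z\|_{C^{2,\delta}}^4$ whenever $\|d(z,h)\|_{L^\infty}\ge1$, i.e. whenever the distance between the curves is at most $1$. -/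

import Mathlib

open Real Filter Topology MeasureTheory
open scoped NNReal ENNReal ContDiff

noncomputable section

namespace BirkhoffRott

instance fact_two_pi_pos : Fact (0 < 2 * π) := ⟨Real.two_pi_pos⟩

/-! ### Curves

The plane is identified with `ℂ`, so that `x · y` is `inner ℝ x y` and
`(x₁, x₂)^⊥ = (-x₂, x₁)` is multiplication by `I`. -/

/-- Rotation by a right angle, `(x₁, x₂)^⊥ = (-x₂, x₁)`. -/
def perp (x : ℂ) : ℂ := Complex.I * x

/-- A horizontally `2π`-periodic parametrized curve, `z(α + 2π) = z(α) + (2π, 0)`,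
of class `C^{2,δ}`. -/
structure IsC2HolderCurve (δ : ℝ≥0) (z : ℝ → ℂ) : Prop where
  periodic : ∀ α, z (α + 2 * π) = z α + 2 * π
  contDiff : ContDiff ℝ 2 z
  holder : MemHolder δ (deriv (deriv z))

/-- The `C^{2,δ}` norm of a periodic curve. Only the curve itself is unbounded on `ℝ`; it is
measured on one period. -/
def c2HolderNorm (δ : ℝ≥0) (z : ℝ → ℂ) : ℝ≥0∞ :=
  (⨆ α ∈ Set.Icc (-π) π, ‖z α‖ₑ) + (⨆ α, ‖deriv z α‖ₑ) + (⨆ α, ‖deriv (deriv z) α‖ₑ)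
    + eHolderNorm δ (deriv (deriv z))

/-- The arc-chord function `F(z)(α, β) = |β|² / |z(α) - z(α - β)|²`, with
`F(z)(α, 0) = 1 / |∂_α z(α)|²`. It is `∞` where a denominator vanishes. -/
def arcChord (z : ℝ → ℂ) (α β : ℝ) : ℝ≥0∞ :=
  if β = 0 then (‖deriv z α‖ₑ ^ 2)⁻¹ else ‖β‖ₑ ^ 2 / ‖z α - z (α - β)‖ₑ ^ 2

/-- `‖F(z)‖_{L^∞}`. -/
def arcChordNorm (z : ℝ → ℂ) : ℝ≥0∞ := ⨆ α, ⨆ β, arcChord z α β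

/-- `‖d(z, h)‖_{L^∞}` for `d(z, h)(α, β) = 1 / |z(α) - h(α - β)|²` (`∞` if the curves touch). -/
def distNorm (z h : ℝ → ℂ) : ℝ≥0∞ := ⨆ α, ⨆ β, (‖z α - h (α - β)‖ₑ ^ 2)⁻¹

/-! ### Function spaces on the circle `𝕋 = ℝ / 2πℤ` -/

/-- `L²(𝕋)`, real valued. -/
abbrev L2 : Type := Lp ℝ 2 (volume : Measure (AddCircle (2 * π)))

/-- `g` is the weak derivative of `f` on the circle: `∫ f φ' = - ∫ g φ` for all smooth `φ`
(`ψ` is the derivative of `φ`). -/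
def IsWeakDeriv (f g : L2) : Prop :=
  ∀ φ ψ : C(AddCircle (2 * π), ℝ), ContDiff ℝ ∞ (fun t : ℝ => φ t) →
    (∀ t : ℝ, HasDerivAt (fun s : ℝ => φ s) (ψ t) t) →
    ∫ x, f x * ψ x = - ∫ x, g x * φ x

theorem integrable_mul_continuousMap (f : L2) (φ : C(AddCircle (2 * π), ℝ)) :
    Integrable (fun x => f x * φ x) (volume : Measure (AddCircle (2 * π))) := by
  have h1 : Integrable f (volume : Measure (AddCircle (2 * π))) :=
    (Lp.memLp f).integrable (by norm_num)
  exact h1.mul_bdd (c := ‖φ‖) φ.continuous.aestronglyMeasurable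
    (Filter.Eventually.of_forall fun x => φ.norm_coe_le_norm x)

theorem integral_add_mul (f g : L2) (φ : C(AddCircle (2 * π), ℝ)) :
    ∫ x, (f + g : L2) x * φ x = (∫ x, f x * φ x) + ∫ x, g x * φ x := by
  rw [← integral_add (integrable_mul_continuousMap f φ) (integrable_mul_continuousMap g φ)]
  refine integral_congr_ae ?_
  filter_upwards [Lp.coeFn_add f g] with x hx
  rw [hx, Pi.add_apply, add_mul]

theorem integral_smul_mul (c : ℝ) (f : L2) (φ : C(AddCircle (2 * π), ℝ)) :
    ∫ x, (c • f : L2) x * φ x = c * ∫ x, f x * φ x := by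
  rw [← integral_const_mul]
  refine integral_congr_ae ?_
  filter_upwards [Lp.coeFn_smul c f] with x hx
  rw [hx, Pi.smul_apply, smul_eq_mul, mul_assoc]

/-- The Sobolev space `H¹(𝕋)`: pairs `(f, ∂f)` of an `L²` function and its `L²` weak derivative,
with the norm `(‖f‖² + ‖∂f‖²)^{1/2}`. -/
def H1 : Submodule ℝ (WithLp 2 (L2 × L2)) where
  carrier := {p | IsWeakDeriv p.fst p.snd}
  zero_mem' := by
    intro φ ψ _ _
    have h : ∀ χ : C(AddCircle (2 * π), ℝ), ∫ x, (0 : L2) x * χ x = 0 := by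
      intro χ
      have := integral_smul_mul 0 (0 : L2) χ
      simpa only [zero_smul, zero_mul] using this
    rw [WithLp.zero_fst, WithLp.zero_snd, h ψ, h φ, neg_zero]
  add_mem' := by
    intro p q hp hq φ ψ hφ hψ
    rw [WithLp.add_fst, WithLp.add_snd, integral_add_mul, integral_add_mul,
      hp φ ψ hφ hψ, hq φ ψ hφ hψ]
    ring
  smul_mem' := by
    intro c p hp φ ψ hφ hψ
    rw [WithLp.smul_fst, WithLp.smul_snd, integral_smul_mul, integral_smul_mul, hp φ ψ hφ hψ]
    ring

/-- The `L²` function underlying an element of `H¹`. -/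
def H1.toL2 (f : H1) : L2 := (f : WithLp 2 (L2 × L2)).fst

/-- `L² × L²` with the norm `‖(u, v)‖ = ‖u‖ + ‖v‖`. -/
abbrev L2Pair : Type := WithLp 1 (L2 × L2)

/-- `H¹ × H¹` with the norm `‖(u, v)‖ = ‖u‖ + ‖v‖`. -/
abbrev H1Pair : Type := WithLp 1 (H1 × H1)

/-! ### Principal values and the operators -/

section PrincipalValue

variable {E : Type*} [NormedAddCommGroup E] [NormedSpace ℝ E]

/-- `PV ∫_ℝ f(β) dβ = a`: the limit over `ε < |β| < R`, as `ε → 0⁺` and `R → ∞`. -/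
def HasPV (f : ℝ → E) (a : E) : Prop :=
  (∀ ε R : ℝ, 0 < ε → IntegrableOn f {β | ε < |β| ∧ |β| < R}) ∧
  Tendsto (fun p : ℝ × ℝ => ∫ β in {β | p.1 < |β| ∧ |β| < p.2}, f β)
    (𝓝[>] 0 ×ˢ atTop) (𝓝 a)

open Classical in
/-- The value of `PV ∫_ℝ f(β) dβ` (zero if it does not exist). -/
def pv (f : ℝ → E) : E := if h : ∃ a, HasPV f a then h.choose else 0

theorem HasPV.pv_eq {f : ℝ → E} {a : E} (h : HasPV f a) : pv f = a := by
  have hex : ∃ a, HasPV f a := ⟨a, h⟩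
  rw [pv, dif_pos hex]
  exact tendsto_nhds_unique hex.choose_spec.2 h.2

end PrincipalValue

/-- The integrand `(x(α) - y(α-β))^⊥ / |x(α) - y(α-β)|² u(α-β)` of the Birkhoff–Rott integral
along the curve `y`, evaluated on the curve `x`. -/
def brIntegrand (y x : ℝ → ℂ) (u : L2) (α β : ℝ) : ℂ :=
  (u ((α - β : ℝ) : AddCircle (2 * π)) / ‖x α - y (α - β)‖ ^ 2) • perp (x α - y (α - β))

/-- The integrand of `2 BR(u, y)_x(α) · ∂_α x(α)`, up to the factor `1/π`. -/
def tangentialIntegrand (y x : ℝ → ℂ) (u : L2) (α β : ℝ) : ℝ :=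
  inner ℝ (brIntegrand y x u α β) (deriv x α)

/-- The Birkhoff–Rott integral
`BR(u, y)_x(α) = (1/2π) PV ∫ (x(α) - y(β))^⊥ / |x(α) - y(β)|² u(β) dβ`. -/
def BR (u : L2) (y x : ℝ → ℂ) (α : ℝ) : ℂ :=
  (1 / (2 * π)) • pv (brIntegrand y x u α)

/-- `2 BR(u, y)_x(α) · ∂_α x(α)`, that is
`(1/π) PV ∫ (x(α) - y(β))^⊥ · ∂_α x(α) / |x(α) - y(β)|² u(β) dβ`. The scalar product stands
inside the principal value; see `tangentialBR_eq` for the comparison with `BR`. -/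
def tangentialBR (y x : ℝ → ℂ) (u : L2) (α : ℝ) : ℝ :=
  (1 / π) * pv (tangentialIntegrand y x u α)

/-- Wherever the vector-valued principal value exists, `tangentialBR` is `2 BR · ∂_α x`. -/
theorem tangentialBR_eq (y x : ℝ → ℂ) (u : L2) (α : ℝ)
    (h : ∃ a, HasPV (brIntegrand y x u α) a) :
    tangentialBR y x u α = inner ℝ ((2 : ℝ) • BR u y x α) (deriv x α) := by
  obtain ⟨a, ha⟩ := h
  have hL : HasPV (tangentialIntegrand y x u α) (inner ℝ a (deriv x α)) := by
    have key : tangentialIntegrand y x u α =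
        fun β => innerSL ℝ (deriv x α) (brIntegrand y x u α β) := by
      funext β
      simp only [tangentialIntegrand, innerSL_apply_apply, real_inner_comm]
    refine ⟨fun ε R hε => ?_, ?_⟩
    · rw [key]
      exact (innerSL ℝ (deriv x α)).integrable_comp (ha.1 ε R hε)
    · have h2 := ((innerSL ℝ (deriv x α)).continuous.tendsto a).comp ha.2
      rw [innerSL_apply_apply, real_inner_comm] at h2
      refine h2.congr' ?_
      have hpos : ∀ᶠ p : ℝ × ℝ in 𝓝[>] (0 : ℝ) ×ˢ (atTop : Filter ℝ), 0 < p.1 :=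
        tendsto_fst.eventually self_mem_nhdsWithin
      filter_upwards [hpos] with p hp
      rw [key]
      exact ((innerSL ℝ (deriv x α)).integral_comp_comm (ha.1 p.1 p.2 hp)).symm
  rw [tangentialBR, hL.pv_eq, BR, ha.pv_eq, smul_smul, real_inner_smul_left]
  congr 1
  field_simp

/-- `T₁(u) = 2 BR(u, z)_z · ∂_α z`. -/
def T₁ (z : ℝ → ℂ) : L2 → ℝ → ℝ := tangentialBR z z

/-- `T₂(v) = 2 BR(v, h)_z · ∂_α z`. -/
def T₂ (z h : ℝ → ℂ) : L2 → ℝ → ℝ := tangentialBR h z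

/-- `T₃(u) = 2 BR(u, z)_h · ∂_α h`. -/
def T₃ (z h : ℝ → ℂ) : L2 → ℝ → ℝ := tangentialBR z h

/-- `T₄(v) = 2 BR(v, h)_h · ∂_α h`. -/
def T₄ (h : ℝ → ℂ) : L2 → ℝ → ℝ := tangentialBR h h

/-- All four principal values in `T₁, …, T₄` exist, for every density and at every point. -/
def OperatorsDefined (z h : ℝ → ℂ) : Prop :=
  ∀ (u : L2) (α : ℝ),
    (∃ a, HasPV (tangentialIntegrand z z u α) a) ∧ (∃ a, HasPV (tangentialIntegrand h z u α) a) ∧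
    (∃ a, HasPV (tangentialIntegrand z h u α) a) ∧ (∃ a, HasPV (tangentialIntegrand h h u α) a)

/-- The bounded operator `S : L² × L² → H¹ × H¹` is the matrix operator
`(u, v) ↦ (T₁ u + T₂ v, T₃ u + T₄ v)`. -/
def IsMatrixOperator (z h : ℝ → ℂ) (S : L2Pair →L[ℝ] H1Pair) : Prop :=
  ∀ w : L2Pair, ∀ᵐ α : ℝ,
    H1.toL2 (S w).fst (α : AddCircle (2 * π)) = T₁ z w.fst α + T₂ z h w.snd α ∧
    H1.toL2 (S w).snd (α : AddCircle (2 * π)) = T₃ z h w.fst α + T₄ h w.snd α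

end BirkhoffRott

end

/-! With the plane identified with `ℂ`, the tangential integrand is `Im (x'(α) / (x(α) - y(α-β))) ·
u(α-β)`. Since `u` is periodic and `y` is periodic up to translation by `2π`, summing over periods
replaces `1/w` by `½ cot(w/2)`. The series converges once the shifts by `±2πj` are paired. Each
operator is therefore an integral operator on the circle with kernel `Im (x'(α) · ½ cot((x(α) -
y(γ))/2))`, and its formal derivative in `α` is again such an operator.

For two separated curves the kernel and its derivative are continuous and bounded. For one curve,
the arc-chord condition confines the singularity to the diagonal, and its leading parts, `1/(α-γ)`
for the kernel and `-1/(α-γ)²` for the derivative, are real, so the imaginary part does not see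
them. Taylor expansion then bounds the kernel, while the Hölder continuity of `z''` bounds the
derivative by a multiple of `1 + |α-γ|^(δ-1)`, which is integrable (`abs_kernel_self_le`).

Schur's test turns such a majorant into an `L²` bound. Cutting the kernel off near the diagonal
gives continuous kernels, compact by Arzelà–Ascoli, which converge in operator norm; hence the limit
is compact (`IsDominatedKernel.isCompactOperator`). Fubini and an integration by parts on each
slice, with no boundary term because the kernel has no jump on the diagonal, identify the second
operator as the weak derivative of the first. So the pair maps `L²` compactly into the closed
subspace `H1` (`IsDominatedKernel.exists_H1_operator`).

With `N` the curve norm and `s` the square root of the arc-chord or distance constant, every kernel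
bound has the form `9 s² N²`. The four operators thus cost `F N²`, `D N²`, `D` and a constant, up to
factors depending on `δ` and `h`. As `F`, `D`, `N ≥ 1`, all are at most `F² D² N⁴`. -/

namespace BirkhoffRott

/-! ### Integral operators on the circle -/

/-- Schur's test for a convolution-type majorant. -/
theorem lintegral_sq_lintegral_sub_mul_le {w f : AddCircle (2 * π) → ℝ≥0∞}
    (hw : Measurable w) (hf : Measurable f) :
    ∫⁻ a, (∫⁻ c, w (a - c) * f c) ^ 2 ≤ (∫⁻ t, w t) ^ 2 * ∫⁻ c, f c ^ 2 := by
  have hsub (a : AddCircle (2 * π)) : Measurable fun c => w (a - c) :=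
    hw.comp (measurable_const.sub measurable_id)
  have hI (a : AddCircle (2 * π)) : ∫⁻ c, w (a - c) = ∫⁻ t, w t :=
    lintegral_sub_left_eq_self w a
  have hpt (a : AddCircle (2 * π)) :
      (∫⁻ c, w (a - c) * f c) ^ 2 ≤ (∫⁻ t, w t) * ∫⁻ c, w (a - c) * f c ^ 2 := by
    have h := ENNReal.lintegral_mul_le_Lp_mul_Lq (volume : Measure (AddCircle (2 * π)))
      Real.HolderConjugate.two_two
      -- Cauchy–Schwarz with the weight split as `w = w^½ · w^½`, one half kept with `f`.
      (f := fun c => w (a - c) ^ (1 / 2 : ℝ)) (g := fun c => w (a - c) ^ (1 / 2 : ℝ) * f c)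
      ((hsub a).pow_const _).aemeasurable (((hsub a).pow_const _).mul hf).aemeasurable
    have hhalf (x : ℝ≥0∞) : x ^ (1 / 2 : ℝ) * x ^ (1 / 2 : ℝ) = x := by
      rw [← ENNReal.rpow_add_of_nonneg _ _ (by norm_num) (by norm_num)]; norm_num
    have e1 : ∀ c, ((fun c => w (a - c) ^ (1 / 2 : ℝ)) *
        (fun c => w (a - c) ^ (1 / 2 : ℝ) * f c)) c = w (a - c) * f c := by
      intro c
      simp only [Pi.mul_apply]
      rw [← mul_assoc, hhalf]
    have e2 : ∀ c, (w (a - c) ^ (1 / 2 : ℝ)) ^ (2 : ℝ) = w (a - c) := by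
      intro c
      rw [← ENNReal.rpow_mul]; norm_num
    have e3 : ∀ c, (w (a - c) ^ (1 / 2 : ℝ) * f c) ^ (2 : ℝ) = w (a - c) * f c ^ 2 := by
      intro c
      rw [ENNReal.mul_rpow_of_nonneg _ _ (by norm_num), e2]; norm_num
    simp only [e1, e2, e3, hI] at h
    calc (∫⁻ c, w (a - c) * f c) ^ 2
        ≤ ((∫⁻ t, w t) ^ (1 / 2 : ℝ) * (∫⁻ c, w (a - c) * f c ^ 2) ^ (1 / 2 : ℝ)) ^ 2 := by
          gcongr
      _ = _ := by
          rw [mul_pow, sq, sq, hhalf, hhalf]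
  calc ∫⁻ a, (∫⁻ c, w (a - c) * f c) ^ 2
      ≤ ∫⁻ a, (∫⁻ t, w t) * ∫⁻ c, w (a - c) * f c ^ 2 := lintegral_mono hpt
    _ = (∫⁻ t, w t) * ∫⁻ a, ∫⁻ c, w (a - c) * f c ^ 2 := by
        rw [lintegral_const_mul]
        exact Measurable.lintegral_prod_right' (f := fun p : AddCircle (2 * π) × AddCircle (2 * π) =>
          w (p.1 - p.2) * f p.2 ^ 2) (by fun_prop)
    _ = (∫⁻ t, w t) * ∫⁻ c, ∫⁻ a, w (a - c) * f c ^ 2 := by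
        rw [lintegral_lintegral_swap]
        exact Measurable.aemeasurable (by fun_prop)
    _ = (∫⁻ t, w t) ^ 2 * ∫⁻ c, f c ^ 2 := by
        have : ∀ c, ∫⁻ a, w (a - c) * f c ^ 2 = (∫⁻ t, w t) * f c ^ 2 := by
          intro c
          rw [lintegral_mul_const _ (by fun_prop), lintegral_sub_right_eq_self w c]
        simp only [this]
        rw [lintegral_const_mul _ (by fun_prop), sq, mul_assoc]

/-- `T` is the integral operator on `L²(𝕋)` with kernel `k`. -/
def IsIntegralOperator (k : AddCircle (2 * π) → AddCircle (2 * π) → ℝ) (T : L2 →L[ℝ] L2) : Prop :=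
  ∀ u : L2, T u =ᵐ[volume] fun a => ∫ c, k a c * u c

/-- A measurable kernel dominated by `w (a - c)`. -/
structure IsDominatedKernel (k : AddCircle (2 * π) → AddCircle (2 * π) → ℝ)
    (w : AddCircle (2 * π) → ℝ) : Prop where
  measurable : Measurable (Function.uncurry k)
  bound : ∀ a c, |k a c| ≤ w (a - c)
  measurable_weight : Measurable w
  integrable : Integrable w

theorem eLpNorm_two_sq (f : AddCircle (2 * π) → ℝ) :
    eLpNorm f 2 volume ^ 2 = ∫⁻ a, ‖f a‖ₑ ^ 2 := by
  rw [eLpNorm_eq_lintegral_rpow_enorm_toReal (by norm_num) (by norm_num)]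
  rw [← ENNReal.rpow_natCast, ← ENNReal.rpow_mul]
  norm_num

namespace IsDominatedKernel

variable {k : AddCircle (2 * π) → AddCircle (2 * π) → ℝ} {w : AddCircle (2 * π) → ℝ}

theorem weight_nonneg (h : IsDominatedKernel k w) (t : AddCircle (2 * π)) : 0 ≤ w t := by
  have := h.bound t 0
  rw [sub_zero] at this
  exact (abs_nonneg _).trans this

theorem enorm_le (h : IsDominatedKernel k w) (a c : AddCircle (2 * π)) :
    ‖k a c‖ₑ ≤ ‖w (a - c)‖ₑ := by
  rw [Real.enorm_eq_ofReal_abs, Real.enorm_eq_ofReal_abs]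
  exact ENNReal.ofReal_le_ofReal ((h.bound a c).trans (le_abs_self _))

theorem measurable_mul (h : IsDominatedKernel k w) (u : L2) :
    Measurable fun p : AddCircle (2 * π) × AddCircle (2 * π) => k p.1 p.2 * u p.2 :=
  h.measurable.mul ((Lp.stronglyMeasurable u).measurable.comp measurable_snd)

theorem lintegral_sq_le (h : IsDominatedKernel k w) (u : L2) :
    ∫⁻ a, (∫⁻ c, ‖k a c * u c‖ₑ) ^ 2 ≤ (∫⁻ t, ‖w t‖ₑ) ^ 2 * eLpNorm u 2 volume ^ 2 := by
  rw [eLpNorm_two_sq]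
  refine le_trans (lintegral_mono fun a => ?_)
    (lintegral_sq_lintegral_sub_mul_le h.measurable_weight.enorm
      (Lp.stronglyMeasurable u).measurable.enorm)
  gcongr with c
  rw [enorm_mul]
  gcongr
  exact h.enorm_le a c

theorem ae_integrable (h : IsDominatedKernel k w) (u : L2) :
    ∀ᵐ a, Integrable fun c => k a c * u c := by
  have hfin : ∫⁻ a, (∫⁻ c, ‖k a c * u c‖ₑ) ^ 2 ≠ ⊤ := by
    refine ne_top_of_le_ne_top ?_ (h.lintegral_sq_le u)
    exact ENNReal.mul_ne_top (ENNReal.pow_ne_top h.integrable.2.ne)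
      (ENNReal.pow_ne_top (Lp.eLpNorm_ne_top u))
  have hm : Measurable fun a => (∫⁻ c, ‖k a c * u c‖ₑ) ^ 2 :=
    (Measurable.lintegral_prod_right' (f := fun p : AddCircle (2 * π) × AddCircle (2 * π) =>
      ‖k p.1 p.2 * u p.2‖ₑ) (h.measurable_mul u).enorm).pow_const 2
  filter_upwards [ae_lt_top hm hfin] with a ha
  refine ⟨((h.measurable_mul u).comp measurable_prodMk_left).aestronglyMeasurable, ?_⟩
  rw [hasFiniteIntegral_iff_enorm]
  by_contra hcon
  rw [not_lt, top_le_iff] at hcon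
  rw [hcon] at ha
  simp at ha

theorem stronglyMeasurable_integral (h : IsDominatedKernel k w) (u : L2) :
    StronglyMeasurable fun a => ∫ c, k a c * u c :=
  (h.measurable_mul u).stronglyMeasurable.integral_prod_right'

theorem eLpNorm_integral_le (h : IsDominatedKernel k w) (u : L2) :
    eLpNorm (fun a => ∫ c, k a c * u c) 2 volume ≤ (∫⁻ t, ‖w t‖ₑ) * eLpNorm u 2 volume := by
  have key : eLpNorm (fun a => ∫ c, k a c * u c) 2 volume ^ 2
      ≤ ((∫⁻ t, ‖w t‖ₑ) * eLpNorm u 2 volume) ^ 2 := by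
    rw [eLpNorm_two_sq, mul_pow]
    refine le_trans (lintegral_mono fun a => ?_) (h.lintegral_sq_le u)
    gcongr
    exact enorm_integral_le_lintegral_enorm _
  exact (ENNReal.pow_le_pow_left_iff two_ne_zero).1 key

theorem memLp_integral (h : IsDominatedKernel k w) (u : L2) :
    MemLp (fun a => ∫ c, k a c * u c) 2 volume :=
  ⟨(h.stronglyMeasurable_integral u).aestronglyMeasurable,
    (h.eLpNorm_integral_le u).trans_lt
      (ENNReal.mul_lt_top h.integrable.2 (Lp.eLpNorm_lt_top u))⟩

theorem norm_le (h : IsDominatedKernel k w) {T : L2 →L[ℝ] L2} (hT : IsIntegralOperator k T) :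
    ‖T‖ ≤ ∫ t, w t := by
  refine T.opNorm_le_bound (integral_nonneg h.weight_nonneg) fun u => ?_
  rw [Lp.norm_def, Lp.norm_def, eLpNorm_congr_ae (hT u)]
  have hW : ∫ t, w t = (∫⁻ t, ‖w t‖ₑ).toReal := by
    rw [integral_eq_lintegral_of_nonneg_ae (Eventually.of_forall h.weight_nonneg)
      h.measurable_weight.aestronglyMeasurable]
    congr 1
    refine lintegral_congr fun t => ?_
    rw [Real.enorm_of_nonneg (h.weight_nonneg t)]
  rw [hW, ← ENNReal.toReal_mul]
  exact ENNReal.toReal_mono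
    (ENNReal.mul_ne_top h.integrable.2.ne (Lp.eLpNorm_ne_top u)) (h.eLpNorm_integral_le u)

theorem exists_isIntegralOperator (h : IsDominatedKernel k w) :
    ∃ T : L2 →L[ℝ] L2, IsIntegralOperator k T := by
  let T₀ : L2 →ₗ[ℝ] L2 :=
    { toFun := fun u => (h.memLp_integral u).toLp _
      map_add' := by
        intro u v
        rw [← MemLp.toLp_add]
        refine MemLp.toLp_congr _ _ ?_
        filter_upwards [h.ae_integrable u, h.ae_integrable v] with a hu hv
        rw [Pi.add_apply, ← integral_add hu hv]
        refine integral_congr_ae ?_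
        filter_upwards [Lp.coeFn_add u v] with c hc
        rw [hc, Pi.add_apply, mul_add]
      map_smul' := by
        intro r u
        rw [RingHom.id_apply, ← MemLp.toLp_const_smul]
        refine MemLp.toLp_congr _ _ (Eventually.of_forall fun a => ?_)
        simp only [Pi.smul_apply, smul_eq_mul]
        rw [← integral_const_mul]
        refine integral_congr_ae ?_
        filter_upwards [Lp.coeFn_smul r u] with c hc
        rw [hc, Pi.smul_apply, smul_eq_mul]
        ring }
  refine ⟨T₀.mkContinuous (∫⁻ t, ‖w t‖ₑ).toReal fun u => ?_, fun u => ?_⟩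
  · change ‖(h.memLp_integral u).toLp _‖ ≤ _
    rw [Lp.norm_toLp, Lp.norm_def, ← ENNReal.toReal_mul]
    exact ENNReal.toReal_mono
      (ENNReal.mul_ne_top h.integrable.2.ne (Lp.eLpNorm_ne_top u)) (h.eLpNorm_integral_le u)
  · exact (h.memLp_integral u).coeFn_toLp

theorem isIntegralOperator_sub {k' : AddCircle (2 * π) → AddCircle (2 * π) → ℝ}
    {w' : AddCircle (2 * π) → ℝ} (h : IsDominatedKernel k w) (h' : IsDominatedKernel k' w')
    {T T' : L2 →L[ℝ] L2} (hT : IsIntegralOperator k T) (hT' : IsIntegralOperator k' T') :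
    IsIntegralOperator (fun a c => k a c - k' a c) (T - T') := by
  intro u
  rw [sub_apply]
  filter_upwards [Lp.coeFn_sub (T u) (T' u), hT u, hT' u, h.ae_integrable u,
    h'.ae_integrable u] with a h1 h2 h3 h4 h5
  rw [h1, Pi.sub_apply, h2, h3, ← integral_sub h4 h5]
  simp only [sub_mul]

end IsDominatedKernel

/-! ### Compactness of integral operators. -/

theorem exists_integral_norm_le_mul_norm :
    ∃ C : ℝ, 0 ≤ C ∧ ∀ u : L2, ∫ c, ‖u c‖ ≤ C * ‖u‖ := by
  refine ⟨(volume (Set.univ : Set (AddCircle (2 * π))) ^ (1 / 2 : ℝ)).toReal,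
    ENNReal.toReal_nonneg, fun u => ?_⟩
  have h1 := eLpNorm_le_eLpNorm_mul_rpow_measure_univ (p := 1) (q := 2)
    (μ := (volume : Measure (AddCircle (2 * π)))) (by norm_num) (Lp.aestronglyMeasurable u)
  rw [integral_norm_eq_lintegral_enorm (Lp.aestronglyMeasurable u), ← eLpNorm_one_eq_lintegral_enorm,
    Lp.norm_def, ← ENNReal.toReal_mul]
  refine ENNReal.toReal_mono (ENNReal.mul_ne_top ?_ (Lp.eLpNorm_ne_top u)) ?_
  · exact ENNReal.rpow_ne_top_of_nonneg (by norm_num) (measure_ne_top _ _)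
  · refine h1.trans_eq ?_
    rw [mul_comm (eLpNorm u 2 volume)]
    norm_num

theorem L2.integrable (u : L2) : Integrable u (volume : Measure (AddCircle (2 * π))) :=
  (Lp.memLp u).integrable (by norm_num)

/-- Integral operators with continuous kernels are compact. -/
theorem IsIntegralOperator.isCompactOperator_of_continuous
    {k : AddCircle (2 * π) → AddCircle (2 * π) → ℝ} (hk : Continuous (Function.uncurry k))
    {T : L2 →L[ℝ] L2} (hT : IsIntegralOperator k T) : IsCompactOperator T := by
  obtain ⟨C, hC, hCu⟩ := exists_integral_norm_le_mul_norm
  obtain ⟨M, hM⟩ : ∃ M, ∀ p, ‖Function.uncurry k p‖ ≤ M := by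
    obtain ⟨M, hM⟩ := isCompact_univ.exists_bound_of_continuousOn hk.continuousOn
    exact ⟨M, fun p => hM p (Set.mem_univ _)⟩
  have hM0 : 0 ≤ M := (norm_nonneg _).trans (hM (0, 0))
  have huc := CompactSpace.uniformContinuous_of_continuous hk
  have hint (u : L2) (a : AddCircle (2 * π)) : Integrable fun c => k a c * u c :=
    (L2.integrable u).bdd_mul (hk.comp (Continuous.prodMk_right a)).aestronglyMeasurable
      (Eventually.of_forall fun c => hM (a, c))
  have hdist : ∀ ε > 0, ∃ η > 0, ∀ u : L2, ∀ a a' : AddCircle (2 * π), dist a a' < η →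
      dist (∫ c, k a c * u c) (∫ c, k a' c * u c) ≤ ε * (C * ‖u‖) := by
    intro ε hε
    obtain ⟨η, hη, h⟩ := Metric.uniformContinuous_iff.1 huc ε hε
    refine ⟨η, hη, fun u a a' haa => ?_⟩
    rw [dist_eq_norm, ← integral_sub (hint u a) (hint u a')]
    calc ‖∫ c, (k a c * u c - k a' c * u c)‖
        ≤ ∫ c, ε * ‖u c‖ := by
          refine norm_integral_le_of_norm_le ((L2.integrable u).norm.const_mul ε)
            (Eventually.of_forall fun c => ?_)
          rw [← sub_mul, norm_mul]
          gcongr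
          rw [← dist_eq_norm]
          refine (h (a := (a, c)) (b := (a', c)) ?_).le
          rw [Prod.dist_eq, dist_self]
          exact max_lt haa hη
      _ = ε * ∫ c, ‖u c‖ := integral_const_mul _ _
      _ ≤ _ := by gcongr; exact hCu u
  have hcont (u : L2) : Continuous fun a => ∫ c, k a c * u c := by
    rw [Metric.continuous_iff]
    intro a ε hε
    obtain ⟨η, hη, h⟩ := hdist (ε / (C * ‖u‖ + 1)) (by positivity)
    refine ⟨η, hη, fun a' ha' => (h u a' a ha').trans_lt ?_⟩
    rw [div_mul_eq_mul_div, div_lt_iff₀ (by positivity)]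
    nlinarith [norm_nonneg u]
  -- `T` factors through the continuous functions. Arzelà–Ascoli gives compactness there, and the
  -- continuous inclusion into `L²` preserves it.
  let G : L2 → BoundedContinuousFunction (AddCircle (2 * π)) ℝ := fun u =>
    BoundedContinuousFunction.mkOfCompact ⟨_, hcont u⟩
  have hG (u : L2) : T u = BoundedContinuousFunction.toLp 2 volume ℝ (G u) := by
    refine Lp.ext ?_
    filter_upwards [hT u, BoundedContinuousFunction.coeFn_toLp 2 volume ℝ (G u)] with a h1 h2
    rw [h1, h2]
    rfl
  have hcomp : IsCompact (closure (G '' Metric.closedBall 0 1)) := by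
    refine BoundedContinuousFunction.arzela_ascoli (Metric.closedBall 0 (M * C))
      (isCompact_closedBall _ _) _ ?_ ?_
    · rintro _ a ⟨u, hu, rfl⟩
      rw [mem_closedBall_zero_iff] at hu ⊢
      change ‖∫ c, k a c * u c‖ ≤ _
      calc ‖∫ c, k a c * u c‖ ≤ ∫ c, M * ‖u c‖ := by
            refine norm_integral_le_of_norm_le ((L2.integrable u).norm.const_mul M)
              (Eventually.of_forall fun c => ?_)
            rw [norm_mul]
            gcongr
            exact hM (a, c)
        _ = M * ∫ c, ‖u c‖ := integral_const_mul _ _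
        _ ≤ M * (C * 1) := by gcongr; exact (hCu u).trans (by gcongr)
        _ = M * C := by ring
    · intro a
      rw [Metric.equicontinuousAt_iff]
      intro ε hε
      -- The `+ 1` avoids dividing by `C = 0` and makes the final inequality strict.
      obtain ⟨η, hη, h⟩ := hdist (ε / (C + 1)) (by positivity)
      refine ⟨η, hη, ?_⟩
      rintro a' ha' ⟨_, u, hu, rfl⟩
      rw [mem_closedBall_zero_iff] at hu
      rw [dist_comm] at ha'
      refine (h u a a' ha').trans_lt ?_
      calc ε / (C + 1) * (C * ‖u‖) ≤ ε / (C + 1) * (C * 1) := by gcongr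
        _ < ε := by
          rw [div_mul_eq_mul_div, div_lt_iff₀ (by positivity)]
          nlinarith
  rw [isCompactOperator_iff_exists_mem_nhds_image_subset_compact]
  refine ⟨Metric.closedBall 0 1, Metric.closedBall_mem_nhds _ one_pos,
    BoundedContinuousFunction.toLp 2 volume ℝ '' closure (G '' Metric.closedBall 0 1),
    hcomp.image (ContinuousLinearMap.continuous _), ?_⟩
  rintro _ ⟨u, hu, rfl⟩
  exact ⟨G u, subset_closure ⟨u, hu, rfl⟩, (hG u).symm⟩

theorem volume_singleton_eq_zero (t : AddCircle (2 * π)) : volume {t} = 0 := by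
  have h := AddCircle.volume_closedBall (T := 2 * π) (x := t) 0
  rw [Metric.closedBall_zero, mul_zero, min_eq_right Real.two_pi_pos.le, ENNReal.ofReal_zero] at h
  exact h

/-- A continuous cutoff on the circle, vanishing for `‖t‖ ≤ 1 / (n + 1)` and equal to one for
`‖t‖ ≥ 2 / (n + 1)`. -/
noncomputable def cutoff (n : ℕ) (t : AddCircle (2 * π)) : ℝ :=
  max 0 (min 1 ((n + 1) * ‖t‖ - 1))

theorem continuous_cutoff (n : ℕ) : Continuous (cutoff n) := by
  unfold cutoff
  fun_prop

theorem cutoff_nonneg (n : ℕ) (t : AddCircle (2 * π)) : 0 ≤ cutoff n t := le_max_left _ _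

theorem cutoff_le_one (n : ℕ) (t : AddCircle (2 * π)) : cutoff n t ≤ 1 :=
  max_le zero_le_one (min_le_left _ _)

theorem cutoff_eventually_eq_zero (n : ℕ) : ∀ᶠ t in 𝓝 0, cutoff n t = 0 := by
  have : ∀ᶠ t : AddCircle (2 * π) in 𝓝 0, (n + 1 : ℝ) * ‖t‖ < 1 := by
    have hc : Continuous fun t : AddCircle (2 * π) => (n + 1 : ℝ) * ‖t‖ := by fun_prop
    refine hc.continuousAt.eventually_lt continuousAt_const ?_
    simp
  filter_upwards [this] with t ht
  refine max_eq_left ((min_le_right _ _).trans ?_)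
  linarith

theorem tendsto_cutoff {t : AddCircle (2 * π)} (ht : t ≠ 0) :
    Tendsto (fun n => cutoff n t) atTop (𝓝 1) := by
  refine tendsto_const_nhds.congr' ?_
  have h1 : Tendsto (fun n : ℕ => ((n : ℝ) + 1) * ‖t‖) atTop atTop :=
    (tendsto_natCast_atTop_atTop.atTop_add tendsto_const_nhds).atTop_mul_const (norm_pos_iff.2 ht)
  filter_upwards [h1.eventually_ge_atTop 2] with n hn
  rw [cutoff, min_eq_left (by linarith), max_eq_right zero_le_one]

/-- A dominated kernel that is continuous off the diagonal gives a compact operator. -/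
theorem IsDominatedKernel.isCompactOperator {k : AddCircle (2 * π) → AddCircle (2 * π) → ℝ}
    {w : AddCircle (2 * π) → ℝ} (h : IsDominatedKernel k w)
    (hk : ∀ p : AddCircle (2 * π) × AddCircle (2 * π), p.1 ≠ p.2 →
      ContinuousAt (Function.uncurry k) p)
    {T : L2 →L[ℝ] L2} (hT : IsIntegralOperator k T) : IsCompactOperator T := by
  -- Near the diagonal `kn n` vanishes identically, so it is continuous everywhere whatever `k` does
  -- there.
  let kn (n : ℕ) (a c : AddCircle (2 * π)) : ℝ := k a c * cutoff n (a - c)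
  have hcsub (n : ℕ) : Continuous fun p : AddCircle (2 * π) × AddCircle (2 * π) =>
      cutoff n (p.1 - p.2) := (continuous_cutoff n).comp (continuous_fst.sub continuous_snd)
  have hkn (n : ℕ) : Continuous (Function.uncurry (kn n)) := by
    rw [continuous_iff_continuousAt]
    rintro ⟨a, c⟩
    by_cases hac : a = c
    · have hev : ∀ᶠ p : AddCircle (2 * π) × AddCircle (2 * π) in 𝓝 (a, c),
          Function.uncurry (kn n) p = 0 := by
        have ht : Tendsto (fun p : AddCircle (2 * π) × AddCircle (2 * π) => p.1 - p.2)
            (𝓝 (a, c)) (𝓝 0) := by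
          have := (continuous_fst.sub continuous_snd :
            Continuous fun p : AddCircle (2 * π) × AddCircle (2 * π) => p.1 - p.2).tendsto (a, c)
          simp only [Pi.sub_apply, hac, sub_self] at this
          rw [hac]
          exact this
        filter_upwards [ht.eventually (cutoff_eventually_eq_zero n)] with p hp
        simp only [Function.uncurry, kn, hp, mul_zero]
      exact continuousAt_const.congr (hev.mono fun p hp => hp.symm)
    · exact (hk (a, c) hac).mul (hcsub n).continuousAt
  have hdn (n : ℕ) : IsDominatedKernel (kn n) w :=
    { measurable := (hkn n).measurable
      bound := fun a c => by
        rw [abs_mul, abs_of_nonneg (cutoff_nonneg _ _)]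
        calc |k a c| * cutoff n (a - c) ≤ |k a c| * 1 := by
              gcongr; exact cutoff_le_one _ _
          _ ≤ w (a - c) := by rw [mul_one]; exact h.bound a c
      measurable_weight := h.measurable_weight
      integrable := h.integrable }
  choose Tn hTn using fun n => (hdn n).exists_isIntegralOperator
  have hmw (n : ℕ) : Measurable fun t => w t * (1 - cutoff n t) :=
    h.measurable_weight.mul (measurable_const.sub (continuous_cutoff n).measurable)
  -- The truncation error is dominated by `w (1 - cutoff n)`, whose integral bounds `‖T - Tn n‖` and
  -- tends to `0` by dominated convergence.
  have hdiff (n : ℕ) : IsDominatedKernel (fun a c => k a c - kn n a c)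
      (fun t => w t * (1 - cutoff n t)) :=
    { measurable := h.measurable.sub (hkn n).measurable
      bound := fun a c => by
        have : k a c - kn n a c = k a c * (1 - cutoff n (a - c)) := by simp only [kn]; ring
        have h1 : 0 ≤ 1 - cutoff n (a - c) := sub_nonneg.2 (cutoff_le_one _ _)
        rw [this, abs_mul, abs_of_nonneg h1]
        gcongr
        exact h.bound a c
      measurable_weight := hmw n
      integrable := by
        refine h.integrable.mono (hmw n).aestronglyMeasurable (Eventually.of_forall fun t => ?_)
        have h1 : 0 ≤ 1 - cutoff n t := sub_nonneg.2 (cutoff_le_one _ _)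
        rw [norm_mul, Real.norm_of_nonneg h1]
        exact mul_le_of_le_one_right (norm_nonneg _) (by linarith [cutoff_nonneg n t]) }
  have hlim : Tendsto (fun n => ∫ t, w t * (1 - cutoff n t)) atTop (𝓝 0) := by
    have := tendsto_integral_of_dominated_convergence (F := fun n t => w t * (1 - cutoff n t))
      (f := fun _ : AddCircle (2 * π) => (0 : ℝ)) (μ := volume) w
      (fun n => (hmw n).aestronglyMeasurable) h.integrable
      (fun n => Eventually.of_forall fun t => by
        have h1 : 0 ≤ 1 - cutoff n t := sub_nonneg.2 (cutoff_le_one _ _)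
        rw [norm_mul, Real.norm_of_nonneg h1, Real.norm_of_nonneg (h.weight_nonneg t)]
        exact mul_le_of_le_one_right (h.weight_nonneg t) (by linarith [cutoff_nonneg n t]))
      (by
        have hne : ∀ᵐ t : AddCircle (2 * π), t ≠ 0 := by
          rw [ae_iff]
          simp [volume_singleton_eq_zero]
        filter_upwards [hne] with t ht
        simpa using ((tendsto_cutoff ht).const_sub 1).const_mul (w t))
    simpa using this
  refine isCompactOperator_of_tendsto (l := atTop) (F := Tn) (f := T) ?_
    (Eventually.of_forall fun n => (hTn n).isCompactOperator_of_continuous (hkn n))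
  rw [tendsto_iff_norm_sub_tendsto_zero]
  refine squeeze_zero (fun _ => norm_nonneg _) (fun n => ?_) hlim
  rw [norm_sub_rev]
  exact (hdiff n).norm_le (h.isIntegralOperator_sub (hdn n) hT (hTn n))

/-! ### Operators into `H¹` -/

/-- The pairing is the `L²` inner product with `φ`. -/
theorem continuous_integral_mul (φ : C(AddCircle (2 * π), ℝ)) :
    Continuous fun u : L2 => ∫ x, u x * φ x := by
  have h (u : L2) : ∫ x, u x * φ x = inner ℝ (ContinuousMap.toLp 2 volume ℝ φ : L2) u := by
    rw [MeasureTheory.L2.inner_def]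
    refine integral_congr_ae ?_
    filter_upwards [ContinuousMap.coeFn_toLp (p := 2) (𝕜 := ℝ) volume φ] with x hx
    rw [hx]
    simp
  simp only [h]
  exact continuous_const.inner continuous_id

/-- Each test pair imposes one closed linear condition. Closedness is what lets a compact operator
with values in `H1` remain compact after its codomain is restricted. -/
theorem isClosed_H1 : IsClosed (H1 : Set (WithLp 2 (L2 × L2))) := by
  have h : (H1 : Set (WithLp 2 (L2 × L2))) = ⋂ (φ : C(AddCircle (2 * π), ℝ))
      (ψ : C(AddCircle (2 * π), ℝ)) (_ : ContDiff ℝ ∞ (fun t : ℝ => φ t))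
      (_ : ∀ t : ℝ, HasDerivAt (fun s : ℝ => φ s) (ψ t) t),
      {p | ∫ x, p.fst x * ψ x = - ∫ x, p.snd x * φ x} := by
    ext p
    simp only [Set.mem_iInter, Set.mem_ofPred_eq]
    rfl
  rw [h]
  refine isClosed_iInter fun φ => isClosed_iInter fun ψ => isClosed_iInter fun _ =>
    isClosed_iInter fun _ => isClosed_eq ?_ ?_
  · exact (continuous_integral_mul ψ).comp (WithLp.continuous_fst 2 _ _)
  · exact ((continuous_integral_mul φ).comp (WithLp.continuous_snd 2 _ _)).neg

/-- The kernel `k` is differentiable in its first variable off the diagonal, with derivative `l`,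
and has no jump on the diagonal. -/
structure IsKernelDeriv (k l : AddCircle (2 * π) → AddCircle (2 * π) → ℝ) : Prop where
  hasDerivAt : ∀ (c : AddCircle (2 * π)) (t : ℝ), (t : AddCircle (2 * π)) ≠ c →
    HasDerivAt (fun s : ℝ => k s c) (l t c) t
  exists_limit : ∀ c, ∃ y, Tendsto (fun a => k a c) (𝓝[≠] c) (𝓝 y)

/-- The covering map is injective on a ball of radius `π`, so points near `t` other than `t` do not
land on its image. -/
theorem tendsto_coe_nhdsNE (t : ℝ) :
    Tendsto (fun s : ℝ => (s : AddCircle (2 * π))) (𝓝[≠] t) (𝓝[≠] (t : AddCircle (2 * π))) := by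
  refine tendsto_nhdsWithin_iff.2 ⟨((AddCircle.continuous_mk' _).tendsto t).mono_left
    nhdsWithin_le_nhds, ?_⟩
  have hball : ∀ᶠ s in 𝓝[≠] t, s ∈ Metric.ball t π :=
    nhdsWithin_le_nhds (Metric.ball_mem_nhds _ Real.pi_pos)
  filter_upwards [hball, self_mem_nhdsWithin] with s hs hne heq
  rw [Metric.mem_ball, Real.dist_eq, abs_lt] at hs
  exact hne ((AddCircle.coe_eq_coe_iff_of_mem_Ico (p := 2 * π) (a := t - π)
    ⟨by linarith, by linarith⟩ ⟨by linarith [Real.pi_pos], by linarith [Real.pi_pos]⟩).1 heq)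

/-- Cut the circle open at `c`. On `(γ, γ + 2π)` the product `k φ` is a primitive of `k ψ + l φ`,
and it has the same one-sided limit at both ends, so the boundary terms cancel. -/
theorem IsKernelDeriv.integral_eq {k l : AddCircle (2 * π) → AddCircle (2 * π) → ℝ}
    (h : IsKernelDeriv k l) {c : AddCircle (2 * π)} (hk : Integrable fun a => k a c)
    (hl : Integrable fun a => l a c) {φ ψ : C(AddCircle (2 * π), ℝ)}
    (hφ : ∀ t : ℝ, HasDerivAt (fun s : ℝ => φ s) (ψ t) t) :
    ∫ a, k a c * ψ a = - ∫ a, l a c * φ a := by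
  obtain ⟨γ, rfl⟩ := QuotientAddGroup.mk_surjective c
  obtain ⟨y, hy⟩ := h.exists_limit (γ : AddCircle (2 * π))
  have hkψ : Integrable fun a => k a γ * ψ a :=
    hk.mul_bdd (c := ‖ψ‖) ψ.continuous.aestronglyMeasurable
      (Eventually.of_forall fun x => ψ.norm_coe_le_norm x)
  have hlφ : Integrable fun a => l a γ * φ a :=
    hl.mul_bdd (c := ‖φ‖) φ.continuous.aestronglyMeasurable
      (Eventually.of_forall fun x => φ.norm_coe_le_norm x)
  rw [eq_neg_iff_add_eq_zero, ← integral_add hkψ hlφ, ← AddCircle.intervalIntegral_preimage _ γ]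
  have hφc : Continuous fun s : ℝ => φ s := φ.continuous.comp (AddCircle.continuous_mk' _)
  have hper : ((γ + 2 * π : ℝ) : AddCircle (2 * π)) = γ := by simp
  have hlt : γ < γ + 2 * π := by linarith [Real.two_pi_pos]
  rw [intervalIntegral.integral_eq_sub_of_hasDerivAt_of_tendsto
    (f := fun s : ℝ => k s γ * φ s) hlt (fa := y * φ γ) (fb := y * φ γ)]
  · ring
  · intro t ht
    have hne : (t : AddCircle (2 * π)) ≠ γ := by
      intro heq
      have := (AddCircle.coe_eq_coe_iff_of_mem_Ico (p := 2 * π) (a := γ) ⟨ht.1.le, ht.2⟩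
        ⟨le_refl γ, hlt⟩).1 heq
      exact ht.1.ne' this
    exact ((h.hasDerivAt γ t hne).mul (hφ t)).congr_deriv (by ring)
  · rw [intervalIntegrable_iff_integrableOn_Ioc_of_le hlt.le]
    exact ((AddCircle.measurePreserving_mk (2 * π) γ).integrable_comp_of_integrable
      (hkψ.add hlφ))
  · refine Tendsto.mul ?_ (hφc.tendsto γ |>.mono_left nhdsWithin_le_nhds)
    exact hy.comp ((tendsto_coe_nhdsNE γ).mono_left (nhdsWithin_mono _ fun s hs => ne_of_gt hs))
  · have h2 := tendsto_coe_nhdsNE (γ + 2 * π)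
    have h3 := (hφc.tendsto (γ + 2 * π)).mono_left (nhdsWithin_le_nhds (s := Set.Iio (γ + 2 * π)))
    rw [hper] at h2 h3
    exact (hy.comp (h2.mono_left (nhdsWithin_mono _ fun s hs => ne_of_lt hs))).mul h3

namespace IsDominatedKernel

variable {k l : AddCircle (2 * π) → AddCircle (2 * π) → ℝ} {w : AddCircle (2 * π) → ℝ}

theorem integrable_left (h : IsDominatedKernel k w) (c : AddCircle (2 * π)) :
    Integrable fun a => k a c :=
  (h.integrable.comp_sub_right c).mono'
    (h.measurable.comp measurable_prodMk_right).aestronglyMeasurable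
    (Eventually.of_forall fun a => h.bound a c)

/-- The majorant `u(c) w(a - c)` is the integrand of a convolution of two `L¹` functions; this is
what justifies Fubini below. -/
theorem integrable_prod (h : IsDominatedKernel k w) (u : L2) (φ : C(AddCircle (2 * π), ℝ)) :
    Integrable (fun p : AddCircle (2 * π) × AddCircle (2 * π) => k p.1 p.2 * u p.2 * φ p.1)
      (volume.prod volume) := by
  have h1 : Integrable (fun p : AddCircle (2 * π) × AddCircle (2 * π) => u p.2 * w (p.1 - p.2))
      (volume.prod volume) :=
    (L2.integrable u).convolution_integrand (ContinuousLinearMap.mul ℝ ℝ) h.integrable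
  have h2 : Integrable (fun p : AddCircle (2 * π) × AddCircle (2 * π) => k p.1 p.2 * u p.2)
      (volume.prod volume) := by
    refine h1.mono (h.measurable_mul u).aestronglyMeasurable (Eventually.of_forall fun p => ?_)
    rw [norm_mul, norm_mul, mul_comm]
    gcongr
    exact (h.bound _ _).trans (le_abs_self _)
  exact h2.mul_bdd (c := ‖φ‖) (φ.continuous.comp continuous_fst).aestronglyMeasurable
    (Eventually.of_forall fun x => φ.norm_coe_le_norm x.1)

theorem integral_operator_mul (h : IsDominatedKernel k w) {T : L2 →L[ℝ] L2}
    (hT : IsIntegralOperator k T) (u : L2) (φ : C(AddCircle (2 * π), ℝ)) :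
    ∫ a, T u a * φ a = ∫ c, u c * ∫ a, k a c * φ a := by
  calc ∫ a, T u a * φ a = ∫ a, ∫ c, k a c * u c * φ a := by
        refine integral_congr_ae ?_
        filter_upwards [hT u] with a ha
        rw [ha, integral_mul_const]
    _ = ∫ c, ∫ a, k a c * u c * φ a := integral_integral_swap (h.integrable_prod u φ)
    _ = _ := by
        refine integral_congr_ae (Eventually.of_forall fun c => ?_)
        simp only
        rw [← integral_const_mul]
        refine integral_congr_ae (Eventually.of_forall fun a => ?_)
        simp only
        ring

/-- An integral operator whose kernel has a dominated derivative maps `L²` compactly into `H¹`. -/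
theorem exists_H1_operator (hk : IsDominatedKernel k w) (hl : IsDominatedKernel l w)
    (hkc : ∀ p : AddCircle (2 * π) × AddCircle (2 * π), p.1 ≠ p.2 →
      ContinuousAt (Function.uncurry k) p)
    (hlc : ∀ p : AddCircle (2 * π) × AddCircle (2 * π), p.1 ≠ p.2 →
      ContinuousAt (Function.uncurry l) p)
    (hkl : IsKernelDeriv k l) :
    ∃ T : L2 →L[ℝ] H1, IsCompactOperator T ∧ ‖T‖ ≤ 2 * ∫ t, w t ∧
      ∀ u, H1.toL2 (T u) =ᵐ[volume] fun a => ∫ c, k a c * u c := by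
  obtain ⟨A, hA⟩ := hk.exists_isIntegralOperator
  obtain ⟨B, hB⟩ := hl.exists_isIntegralOperator
  have hAc := hk.isCompactOperator hkc hA
  have hBc := hl.isCompactOperator hlc hB
  let inl : L2 →L[ℝ] WithLp 2 (L2 × L2) :=
    ((WithLp.prodContinuousLinearEquiv 2 ℝ L2 L2).symm : L2 × L2 →L[ℝ] WithLp 2 (L2 × L2)).comp
      (ContinuousLinearMap.inl ℝ L2 L2)
  let inr : L2 →L[ℝ] WithLp 2 (L2 × L2) :=
    ((WithLp.prodContinuousLinearEquiv 2 ℝ L2 L2).symm : L2 × L2 →L[ℝ] WithLp 2 (L2 × L2)).comp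
      (ContinuousLinearMap.inr ℝ L2 L2)
  let P : L2 →L[ℝ] WithLp 2 (L2 × L2) := inl.comp A + inr.comp B
  have hP (u : L2) : P u = WithLp.toLp 2 (A u, B u) := by
    change WithLp.toLp 2 (A u, (0 : L2)) + WithLp.toLp 2 ((0 : L2), B u) = _
    rw [← WithLp.toLp_add, Prod.mk_add_mk, add_zero, zero_add]
  have hPc : IsCompactOperator P := by
    have := (hAc.clm_comp inl).add (hBc.clm_comp inr)
    exact this
  -- Fubini moves the test function onto the kernel, and the slicewise integration by parts
  -- exchanges `k` for `l`.
  have hmem (u : L2) : P u ∈ H1 := by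
    intro φ ψ _ hφ
    rw [hP]
    change ∫ x, A u x * ψ x = - ∫ x, B u x * φ x
    rw [hk.integral_operator_mul hA, hl.integral_operator_mul hB, ← integral_neg]
    refine integral_congr_ae (Eventually.of_forall fun c => ?_)
    simp only
    rw [hkl.integral_eq (hk.integrable_left c) (hl.integrable_left c) hφ, mul_neg]
  refine ⟨P.codRestrict H1 hmem, ?_, ?_, fun u => ?_⟩
  · exact hPc.codRestrict hmem isClosed_H1
  · have hW : 0 ≤ ∫ t, w t := integral_nonneg hk.weight_nonneg
    refine ContinuousLinearMap.opNorm_le_bound _ (by positivity) fun u => ?_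
    change ‖P u‖ ≤ _
    rw [hP]
    -- The Euclidean norm of the pair is at most the sum; this is the source of the factor `2`.
    calc ‖WithLp.toLp 2 (A u, B u)‖ ≤ ‖A u‖ + ‖B u‖ := by
          rw [WithLp.prod_norm_eq_of_L2]
          refine Real.sqrt_le_iff.2 ⟨by positivity, ?_⟩
          change ‖A u‖ ^ 2 + ‖B u‖ ^ 2 ≤ _
          nlinarith [norm_nonneg (A u), norm_nonneg (B u)]
      _ ≤ (∫ t, w t) * ‖u‖ + (∫ t, w t) * ‖u‖ :=
          add_le_add (A.le_of_opNorm_le (hk.norm_le hA) u) (B.le_of_opNorm_le (hl.norm_le hB) u)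
      _ = _ := by ring
  · change (P u).fst =ᵐ[volume] _
    rw [hP]
    exact hA u

end IsDominatedKernel

/-! ### Principal values and periodization -/

/-- A locally integrable function has a principal value as soon as its symmetric integrals
converge. -/
theorem hasPV_of_tendsto {f : ℝ → ℝ} (hf : ∀ a b, IntervalIntegrable f volume a b) {y : ℝ}
    (hy : Tendsto (fun R : ℝ => ∫ β in -R..R, f β) atTop (𝓝 y)) : HasPV f y := by
  have hset (ε R : ℝ) : {β : ℝ | ε < |β| ∧ |β| < R} = Set.Ioo (-R) R \ Set.Icc (-ε) ε := by
    ext β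
    simp only [Set.mem_ofPred_eq, Set.mem_sdiff, Set.mem_Ioo, Set.mem_Icc, ← abs_lt, ← abs_le,
      not_le]
    exact and_comm
  have hIoo (R : ℝ) : IntegrableOn f (Set.Ioo (-R) R) := by
    rcases le_total (-R) R with h | h
    · exact ((intervalIntegrable_iff_integrableOn_Ioc_of_le h).1 (hf _ _)).mono_set
        Set.Ioo_subset_Ioc_self
    · rw [Set.Ioo_eq_empty (not_lt.2 h)]
      exact integrableOn_empty
  refine ⟨fun ε R _ => ?_, ?_⟩
  · rw [hset]
    exact (hIoo R).mono_set Set.sdiff_subset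
  -- Local integrability makes the excised interval `[-ε, ε]` contribute nothing in the limit.
  · have h0 : Tendsto (fun ε : ℝ => ∫ β in -ε..ε, f β) (𝓝[>] 0) (𝓝 0) := by
      have hc : Continuous fun x : ℝ => ∫ β in (0 : ℝ)..x, f β :=
        intervalIntegral.continuous_primitive hf 0
      have h1 : Continuous fun ε : ℝ => (∫ β in (0 : ℝ)..ε, f β) - ∫ β in (0 : ℝ)..(-ε), f β :=
        hc.sub (hc.comp continuous_neg)
      have h2 := (h1.tendsto 0).mono_left (nhdsWithin_le_nhds (s := Set.Ioi 0))
      simp only [neg_zero, sub_self] at h2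
      refine h2.congr fun ε => ?_
      rw [intervalIntegral.integral_interval_sub_left (hf _ _) (hf _ _)]
    have hmain := (hy.comp tendsto_snd).sub (h0.comp (tendsto_fst (g := (atTop : Filter ℝ))))
    rw [sub_zero] at hmain
    refine hmain.congr' ?_
    -- Keeping `ε < 1 < R` ensures that the excised interval lies inside `(-R, R)`.
    have hε : ∀ᶠ p : ℝ × ℝ in 𝓝[>] (0 : ℝ) ×ˢ (atTop : Filter ℝ), p.1 ∈ Set.Ioo (0 : ℝ) 1 :=
      tendsto_fst.eventually (Ioo_mem_nhdsGT one_pos)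
    have hR : ∀ᶠ p : ℝ × ℝ in 𝓝[>] (0 : ℝ) ×ˢ (atTop : Filter ℝ), 1 < p.2 :=
      tendsto_snd.eventually (eventually_gt_atTop 1)
    filter_upwards [hε, hR] with p hp1 hp2
    obtain ⟨hp0, hp1⟩ := hp1
    rw [hset, setIntegral_sdiff measurableSet_Icc (hIoo _), integral_Icc_eq_integral_Ioc,
      ← integral_Ioc_eq_integral_Ioo, ← intervalIntegral.integral_of_le (by linarith),
      ← intervalIntegral.integral_of_le (by linarith)]
    · rfl
    · intro β hβ
      exact ⟨by linarith [hβ.1], by linarith [hβ.2]⟩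

/-- Periodization of a principal value. -/
theorem hasPV_mul_periodic {κ v s : ℝ → ℝ} {B C D : ℝ}
    (hv : Function.Periodic v (2 * π)) (hvi : ∀ a b, IntervalIntegrable v volume a b)
    (hκ : Measurable κ) (hB : ∀ β, |κ β| ≤ B) (hC : ∀ β, |κ β| * |β| ≤ C)
    (hD : ∀ j : ℕ, ∀ β ∈ Set.Ioc (-π) π,
      |κ (β + 2 * π * (j + 1)) + κ (β - 2 * π * (j + 1))| ≤ D / (j + 1) ^ 2)
    (hs : ∀ β ∈ Set.Ioc (-π) π, β ≠ 0 → HasSum (fun j : ℕ =>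
      κ (β + 2 * π * (j + 1)) + κ (β - 2 * π * (j + 1))) (s β - κ β)) :
    HasPV (fun β => κ β * v β) (∫ β in (-π)..π, s β * v β) := by
  have hπ := Real.pi_pos
  have hmulint (κ' : ℝ → ℝ) (hκ' : Measurable κ') (B' a b : ℝ)
      (hB' : ∀ β ∈ Set.uIoc a b, |κ' β| ≤ B') :
      IntervalIntegrable (fun β => κ' β * v β) volume a b := by
    rw [intervalIntegrable_iff]
    refine (intervalIntegrable_iff.1 (hvi a b)).bdd_mul (c := B') hκ'.aestronglyMeasurable ?_
    exact (ae_restrict_iff' measurableSet_uIoc).2 (Eventually.of_forall hB')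
  have hf (a b : ℝ) : IntervalIntegrable (fun β => κ β * v β) volume a b :=
    hmulint κ hκ B a b fun β _ => hB β
  have hle : -π ≤ π := by linarith
  have hpair_meas (j : ℕ) :
      Measurable fun β : ℝ => κ (β + 2 * π * (j + 1)) + κ (β - 2 * π * (j + 1)) := by fun_prop
  have hsumm : Summable fun j : ℕ => D / ((j : ℝ) + 1) ^ 2 := by
    have h1 : Summable fun j : ℕ => 1 / (((j + 1 : ℕ)) : ℝ) ^ 2 :=
      (summable_nat_add_iff 1).2 (Real.summable_one_div_nat_pow.2 one_lt_two)
    refine (h1.mul_left D).congr fun j => ?_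
    push_cast
    ring
  -- sum over periods
  have hsum : HasSum (fun j : ℕ => ∫ β in (-π)..π,
      (κ (β + 2 * π * (j + 1)) + κ (β - 2 * π * (j + 1))) * v β)
      (∫ β in (-π)..π, (s β - κ β) * v β) := by
    refine intervalIntegral.hasSum_integral_of_dominated_convergence
      (fun j β => D / ((j : ℝ) + 1) ^ 2 * |v β|) (fun j => ?_) (fun j => ?_) ?_ ?_ ?_
    · exact ((hpair_meas j).aestronglyMeasurable).mul
        (intervalIntegrable_iff.1 (hvi _ _)).aestronglyMeasurable
    · refine Eventually.of_forall fun β hβ => ?_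
      rw [Set.uIoc_of_le hle] at hβ
      rw [norm_mul, Real.norm_eq_abs, Real.norm_eq_abs]
      gcongr
      exact hD j β hβ
    · exact Eventually.of_forall fun β _ => hsumm.mul_right _
    · simp only [tsum_mul_right]
      exact (hvi _ _).abs.const_mul _
    · have hne : ∀ᵐ β : ℝ, β ≠ 0 := by
        rw [ae_iff]; simp
      filter_upwards [hne] with β hβ0 hβ
      rw [Set.uIoc_of_le hle] at hβ
      exact (hs β hβ hβ0).mul_right _
  -- Integrals up to odd multiples of `π` consist of whole periods; the periods `n + 1` to the right
  -- and to the left are translated back to `(-π, π]` and added as a pair.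
  have hA (n : ℕ) : ∫ β in (-((2 * n + 1) * π))..((2 * n + 1) * π), κ β * v β =
      (∫ β in (-π)..π, κ β * v β) + ∑ j ∈ Finset.range n, ∫ β in (-π)..π,
        (κ (β + 2 * π * (j + 1)) + κ (β - 2 * π * (j + 1))) * v β := by
    induction n with
    | zero => simp
    | succ n ih =>
      rw [Finset.sum_range_succ, ← add_assoc, ← ih]
      have hvp (β : ℝ) : v (β + 2 * π * (n + 1)) = v β := by
        have := hv.nat_mul (n + 1) β
        push_cast at this
        rw [← this]
        ring_nf
      have hvm (β : ℝ) : v (β - 2 * π * (n + 1)) = v β := by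
        rw [← hvp (β - 2 * π * (n + 1)), sub_add_cancel]
      have hsplit : ∫ β in (-π)..π,
          (κ (β + 2 * π * (n + 1)) + κ (β - 2 * π * (n + 1))) * v β =
          (∫ β in (-π + 2 * π * (n + 1))..(π + 2 * π * (n + 1)), κ β * v β) +
          ∫ β in (-π - 2 * π * (n + 1))..(π - 2 * π * (n + 1)), κ β * v β := by
        rw [← intervalIntegral.integral_comp_add_right (fun β => κ β * v β),
          ← intervalIntegral.integral_comp_sub_right (fun β => κ β * v β),
          ← intervalIntegral.integral_add]
        · refine intervalIntegral.integral_congr fun β _ => ?_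
          simp only [hvp, hvm]
          ring
        · simp only [hvp]
          exact hmulint _ (by fun_prop) B _ _ fun β _ => hB _
        · simp only [hvm]
          exact hmulint _ (by fun_prop) B _ _ fun β _ => hB _
      rw [hsplit]
      have e1 : -π + 2 * π * (n + 1) = (2 * n + 1) * π := by ring
      have e2 : π + 2 * π * (n + 1) = (2 * (n + 1 : ℕ) + 1) * π := by push_cast; ring
      have e3 : -π - 2 * π * (n + 1) = -((2 * (n + 1 : ℕ) + 1) * π) := by push_cast; ring
      have e4 : π - 2 * π * (n + 1) = -((2 * n + 1) * π) := by ring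
      rw [e1, e2, e3, e4, ← add_assoc,
        intervalIntegral.integral_add_adjacent_intervals (hf _ _) (hf _ _),
        add_comm (∫ β in (-((2 * n + 1) * π))..((2 * (n + 1 : ℕ) + 1) * π), κ β * v β),
        intervalIntegral.integral_add_adjacent_intervals (hf _ _) (hf _ _)]
  have hlimA : Tendsto (fun n : ℕ => ∫ β in (-((2 * n + 1) * π))..((2 * n + 1) * π), κ β * v β)
      atTop (𝓝 (∫ β in (-π)..π, s β * v β)) := by
    have h1 := (hsum.tendsto_sum_nat).const_add (∫ β in (-π)..π, κ β * v β)
    have h2 : (∫ β in (-π)..π, κ β * v β) + ∫ β in (-π)..π, (s β - κ β) * v β =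
        ∫ β in (-π)..π, s β * v β := by
      have hae : ∀ᵐ β : ℝ, β ∈ Set.uIoc (-π) π →
          ∑' j : ℕ, (κ (β + 2 * π * (j + 1)) + κ (β - 2 * π * (j + 1))) * v β =
            (s β - κ β) * v β := by
        have hne : ∀ᵐ β : ℝ, β ≠ 0 := by
          rw [ae_iff]; simp
        filter_upwards [hne] with β hβ0 hβ
        rw [Set.uIoc_of_le hle] at hβ
        exact ((hs β hβ hβ0).mul_right _).tsum_eq
      -- No measurability of `s` is assumed; it is inherited from the series, which equals `s - κ`
      -- almost everywhere.
      have hint : IntervalIntegrable (fun β => (s β - κ β) * v β) volume (-π) π := by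
        have h3 : IntervalIntegrable (fun β =>
            (∑' j : ℕ, (κ (β + 2 * π * (j + 1)) + κ (β - 2 * π * (j + 1)))) * v β)
            volume (-π) π := by
          refine hmulint _ (Measurable.tsum fun j => hpair_meas j)
            (∑' j : ℕ, D / ((j : ℝ) + 1) ^ 2) _ _ fun β hβ => ?_
          rw [Set.uIoc_of_le hle] at hβ
          rw [← Real.norm_eq_abs]
          exact tsum_of_norm_bounded hsumm.hasSum fun j => hD j β hβ
        rw [intervalIntegrable_iff] at h3 ⊢
        refine h3.congr ?_
        refine (ae_restrict_iff' measurableSet_uIoc).2 ?_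
        filter_upwards [hae] with β hβ hβ'
        rw [← hβ hβ', tsum_mul_right]
      rw [← intervalIntegral.integral_add (hf _ _) hint]
      refine intervalIntegral.integral_congr fun β _ => ?_
      ring
    rw [h2] at h1
    exact h1.congr fun n => (hA n).symm
  refine hasPV_of_tendsto hf ?_
  -- from odd multiples of `π` to all radii
  set V : ℝ := ∫ β in (0 : ℝ)..(2 * π), |v β| with hV
  have hC0 : 0 ≤ C := by simpa using hC 0
  -- The leftover pieces are no longer than one period, where `|κ| ≤ C / |β|` is small and `|v|` has
  -- integral at most `V`.
  have htail (n : ℕ) (R : ℝ) (h1 : (2 * n + 1) * π ≤ R) (h2 : R ≤ (2 * n + 1) * π + 2 * π) :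
      |∫ β in ((2 * n + 1) * π)..R, κ β * v β| ≤ C / ((2 * n + 1) * π) * V ∧
      |∫ β in (-R)..(-((2 * n + 1) * π)), κ β * v β| ≤ C / ((2 * n + 1) * π) * V := by
    have hpos : 0 < (2 * n + 1) * π := by positivity
    have hbd (β : ℝ) (hβ : (2 * n + 1) * π ≤ |β|) :
        ‖κ β * v β‖ ≤ C / ((2 * n + 1) * π) * |v β| := by
      rw [norm_mul, Real.norm_eq_abs, Real.norm_eq_abs]
      gcongr
      rw [le_div_iff₀ hpos]
      exact le_trans (by gcongr) (hC β)
    have hVa (a : ℝ) : ∫ β in a..(a + 2 * π), |v β| = V := by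
      have hvabs : Function.Periodic (fun β => |v β|) (2 * π) := fun β => by
        simp only [hv β]
      have := hvabs.intervalIntegral_add_eq a 0
      rwa [zero_add] at this
    have hmono (a b a' : ℝ) (hab : a ≤ b) (ha' : a' ≤ a) (hb' : b ≤ a' + 2 * π) :
        ∫ β in a..b, C / ((2 * n + 1) * π) * |v β| ≤ C / ((2 * n + 1) * π) * V := by
      rw [intervalIntegral.integral_const_mul, ← hVa a']
      gcongr
      exact intervalIntegral.integral_mono_interval ha' hab hb'
        (Eventually.of_forall fun β => abs_nonneg _) (hvi _ _).abs
    constructor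
    · refine le_trans ?_ (hmono _ _ ((2 * n + 1) * π) h1 le_rfl h2)
      rw [← Real.norm_eq_abs]
      refine intervalIntegral.norm_integral_le_of_norm_le h1 (Eventually.of_forall fun β hβ =>
        hbd β (hβ.1.le.trans (le_abs_self _))) ((hvi _ _).abs.const_mul _)
    · refine le_trans ?_ (hmono (-R) (-((2 * n + 1) * π)) (-((2 * n + 1) * π) - 2 * π)
        (by linarith) (by linarith) (by linarith))
      rw [← Real.norm_eq_abs]
      refine intervalIntegral.norm_integral_le_of_norm_le (by linarith)
        (Eventually.of_forall fun β hβ => hbd β ?_) ((hvi _ _).abs.const_mul _)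
      have := neg_le_abs β
      linarith [hβ.2]
  -- The largest `n` with `(2n+1)π ≤ R`, for `R ≥ π`.
  let n (R : ℝ) : ℕ := ⌊(R / π - 1) / 2⌋₊
  have hn : Tendsto n atTop atTop := by
    refine tendsto_nat_floor_atTop.comp ?_
    exact ((tendsto_id.atTop_div_const hπ).atTop_add tendsto_const_nhds).atTop_div_const two_pos
  have hdiff : Tendsto (fun R => (∫ β in (-R)..R, κ β * v β) -
      ∫ β in (-((2 * n R + 1) * π))..((2 * n R + 1) * π), κ β * v β) atTop (𝓝 0) := by
    have h0 : Tendsto (fun m : ℕ => 2 * (C / ((2 * m + 1) * π) * V)) atTop (𝓝 0) := by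
      have h3 : Tendsto (fun m : ℕ => (2 * (m : ℝ) + 1) * π) atTop atTop :=
        ((tendsto_natCast_atTop_atTop.const_mul_atTop two_pos).atTop_add
          tendsto_const_nhds).atTop_mul_const hπ
      have h4 := ((h3.const_div_atTop C).mul_const V).const_mul 2
      simpa using h4
    refine squeeze_zero_norm' ?_ (h0.comp hn)
    filter_upwards [eventually_ge_atTop π] with R hR
    have hnn : 0 ≤ (R / π - 1) / 2 := by
      have : 1 ≤ R / π := (one_le_div hπ).2 hR
      linarith
    have h1 : (2 * n R + 1) * π ≤ R := by
      have h5 : (n R : ℝ) ≤ (R / π - 1) / 2 := Nat.floor_le hnn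
      have h6 : 2 * (n R : ℝ) + 1 ≤ R / π := by linarith
      exact (le_div_iff₀ hπ).1 h6
    have h2 : R ≤ (2 * n R + 1) * π + 2 * π := by
      have h5 : (R / π - 1) / 2 < n R + 1 := Nat.lt_floor_add_one _
      have h6 : R / π ≤ 2 * (n R : ℝ) + 1 + 2 := by linarith
      have := (div_le_iff₀ hπ).1 h6
      linarith
    obtain ⟨h3, h4⟩ := htail (n R) R h1 h2
    have hsplit : (∫ β in (-R)..R, κ β * v β) -
        ∫ β in (-((2 * n R + 1) * π))..((2 * n R + 1) * π), κ β * v β =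
        (∫ β in (-R)..(-((2 * n R + 1) * π)), κ β * v β) +
          ∫ β in ((2 * n R + 1) * π)..R, κ β * v β := by
      rw [← intervalIntegral.integral_add_adjacent_intervals (hf (-R) (-((2 * n R + 1) * π)))
        (hf _ R), ← intervalIntegral.integral_add_adjacent_intervals
        (hf (-((2 * n R + 1) * π)) ((2 * n R + 1) * π)) (hf _ R)]
      ring
    rw [hsplit]
    refine (norm_add_le _ _).trans ?_
    rw [Real.norm_eq_abs, Real.norm_eq_abs]
    simp only [Function.comp_apply]
    linarith
  have := hdiff.add (hlimA.comp hn)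
  rw [zero_add] at this
  refine this.congr fun R => ?_
  simp only [Function.comp_apply]
  ring

/-- `½ cot(w/2)`, the periodization of `1/w`. -/
noncomputable def halfCot (w : ℂ) : ℂ := Complex.cot (w / 2) / 2

/-- The Mittag-Leffler expansion of `π cot(πt)` at `t = w/(2π)`, divided by `2π`. -/
theorem hasSum_halfCot {w : ℂ} (hw : ∀ m : ℤ, w + 2 * π * m ≠ 0) :
    HasSum (fun j : ℕ => 1 / (w + 2 * π * (j + 1)) + 1 / (w - 2 * π * (j + 1)))
      (halfCot w - 1 / w) := by
  have hπ : (π : ℂ) ≠ 0 := Complex.ofReal_ne_zero.2 Real.pi_ne_zero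
  have hmem : w / (2 * π) ∈ Complex.integerComplement := by
    rw [Complex.mem_integerComplement_iff]
    rintro ⟨m, hm⟩
    refine hw (-m) ?_
    have : w = m * (2 * π) := by
      rw [hm]; field_simp
    rw [this]
    push_cast
    ring
  have h1 := (summable_cotTerm hmem).hasSum
  have h2 := cot_series_rep' hmem
  simp only [cotTerm] at h1
  rw [← h2] at h1
  have h3 := h1.mul_left (1 / (2 * π : ℂ))
  have hw0 : w ≠ 0 := by simpa using hw 0
  have hval : 1 / (2 * π : ℂ) * (π * Complex.cot (π * (w / (2 * π))) - 1 / (w / (2 * π))) =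
      halfCot w - 1 / w := by
    have : (π : ℂ) * (w / (2 * π)) = w / 2 := by field_simp
    rw [halfCot, this]
    field_simp
  rw [hval] at h3
  convert! h3 using 2 with j
  have a1 : w + 2 * π * (j + 1) ≠ 0 := by
    have := hw (j + 1); push_cast at this; exact this
  have a2 : w - 2 * π * (j + 1) ≠ 0 := by
    have := hw (-(j + 1)); push_cast at this
    intro h; apply this; rw [← h]; ring
  have c1 : w / (2 * π) - (j + 1) = (w - 2 * π * (j + 1)) / (2 * π) := by field_simp
  have c2 : w / (2 * π) + (j + 1) = (w + 2 * π * (j + 1)) / (2 * π) := by field_simp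
  rw [c1, c2]
  field_simp
  ring

/-- The scalar product of `I w` and `p` is `Im (conj w · p)`, and dividing by `|w|²` gives `Im
(p/w)`. -/
theorem tangentialIntegrand_eq (y x : ℝ → ℂ) (u : L2) (α β : ℝ) :
    tangentialIntegrand y x u α β =
      (deriv x α / (x α - y (α - β))).im * u ((α - β : ℝ) : AddCircle (2 * π)) := by
  rw [tangentialIntegrand, brIntegrand, real_inner_smul_left, perp]
  generalize x α - y (α - β) = w
  generalize deriv x α = p
  rw [Complex.inner, Complex.div_im, ← Complex.normSq_eq_norm_sq]
  simp
  ring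

theorem coe_sub_add_two_pi (α β : ℝ) :
    ((α - (β + 2 * π) : ℝ) : AddCircle (2 * π)) = ((α - β : ℝ) : AddCircle (2 * π)) := by
  have h := AddCircle.coe_add_period (2 * π) (α - (β + 2 * π))
  rw [← h]
  congr 1
  ring

theorem L2.intervalIntegrable_comp_sub (u : L2) (α a b : ℝ) :
    IntervalIntegrable (fun β : ℝ => u ((α - β : ℝ) : AddCircle (2 * π))) volume a b := by
  have hper : Function.Periodic (fun β : ℝ => u ((α - β : ℝ) : AddCircle (2 * π))) (2 * π) := by
    intro β
    simp only
    rw [coe_sub_add_two_pi]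
  have hbase : IntervalIntegrable (fun γ : ℝ => u (γ : AddCircle (2 * π))) volume
      (α - 2 * π) (α - 2 * π + 2 * π) := by
    rw [intervalIntegrable_iff_integrableOn_Ioc_of_le (by linarith [Real.two_pi_pos])]
    exact (AddCircle.measurePreserving_mk (2 * π) (α - 2 * π)).integrable_comp_of_integrable
      (L2.integrable u)
  have h2 := hbase.comp_sub_left α
  refine hper.intervalIntegrable₀ Real.two_pi_pos.ne' ?_ a b
  have e1 : α - (α - 2 * π) = 2 * π := by ring
  have e2 : α - (α - 2 * π + 2 * π) = 0 := by ring
  rw [e1, e2] at h2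
  exact h2.symm

/-- The principal value of the tangential Birkhoff–Rott integral, in periodized form. -/
theorem hasPV_tangentialIntegrand {x y : ℝ → ℂ} (hy : Continuous y)
    (hper : ∀ α, y (α + 2 * π) = y α + 2 * π) {α c B : ℝ} (hc : 0 < c)
    (hlow : ∀ β, c * |β| ≤ ‖x α - y (α - β)‖)
    (hB : ∀ β, |(deriv x α / (x α - y (α - β))).im| ≤ B) (u : L2) :
    HasPV (tangentialIntegrand y x u α)
      (∫ β in (-π)..π, (deriv x α * halfCot (x α - y (α - β))).im *
        u ((α - β : ℝ) : AddCircle (2 * π))) := by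
  have hπ := Real.pi_pos
  have hfun : tangentialIntegrand y x u α = fun β =>
      (deriv x α / (x α - y (α - β))).im * u ((α - β : ℝ) : AddCircle (2 * π)) :=
    funext fun β => tangentialIntegrand_eq y x u α β
  rw [hfun]
  set w : ℝ → ℂ := fun β => x α - y (α - β) with hw
  have hwc : Continuous w := continuous_const.sub (hy.comp (continuous_const.sub continuous_id))
  have hshift1 (β : ℝ) : w (β + 2 * π) = w β + 2 * π := by
    have := hper (α - (β + 2 * π))
    have e : α - (β + 2 * π) + 2 * π = α - β := by ring
    rw [e] at this
    simp only [hw]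
    rw [this]
    ring
  have hshiftN (j : ℕ) : ∀ β : ℝ, w (β + 2 * π * j) = w β + 2 * π * j := by
    induction j with
    | zero => intro β; simp
    | succ j ih =>
      intro β
      have e : β + 2 * π * ((j + 1 : ℕ) : ℝ) = (β + 2 * π * j) + 2 * π := by push_cast; ring
      rw [e, hshift1, ih]
      push_cast
      ring
  have hshiftN' (j : ℕ) (β : ℝ) : w (β - 2 * π * j) = w β - 2 * π * j := by
    have := hshiftN j (β - 2 * π * j)
    rw [sub_add_cancel] at this
    rw [this]
    ring
  have hplus (j : ℕ) (β : ℝ) : w (β + 2 * π * (j + 1)) = w β + 2 * π * (j + 1) := by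
    have := hshiftN (j + 1) β; push_cast at this; exact this
  have hminus (j : ℕ) (β : ℝ) : w (β - 2 * π * (j + 1)) = w β - 2 * π * (j + 1) := by
    have := hshiftN' (j + 1) β; push_cast at this; exact this
  obtain ⟨Mw, hMw⟩ := (isCompact_Icc (a := -π) (b := π)).exists_bound_of_continuousOn
    hwc.continuousOn
  have hMw0 : 0 ≤ Mw := (norm_nonneg _).trans (hMw 0 ⟨by linarith, by linarith⟩)
  -- `C` comes from `c|β| ≤ |w|`. For `D`, the paired terms sum to `2w(β)/(w₊ w₋)` times `x'(α)`,
  -- and `|w₊|`, `|w₋|` are at least `cπ(j+1)` because `|β ± 2π(j+1)| ≥ π(j+1)` on `(-π, π]`.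
  refine hasPV_mul_periodic (C := ‖deriv x α‖ / c) (B := B)
    (D := ‖deriv x α‖ * (2 * Mw / (c * π) ^ 2)) ?_ (L2.intervalIntegrable_comp_sub u α) ?_ hB
    ?_ ?_ ?_
  · intro β
    simp only
    rw [coe_sub_add_two_pi]
  · exact Complex.measurable_im.comp (measurable_const.div hwc.measurable)
  · intro β
    rw [le_div_iff₀ hc]
    rcases eq_or_ne β 0 with rfl | hβ
    · simp
    have hwpos : 0 < ‖w β‖ := lt_of_lt_of_le (by positivity) (hlow β)
    calc |(deriv x α / w β).im| * |β| * c = |(deriv x α / w β).im| * (c * |β|) := by ring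
      _ ≤ ‖deriv x α / w β‖ * ‖w β‖ := by
          gcongr
          · exact Complex.abs_im_le_norm _
          · exact hlow β
      _ = ‖deriv x α‖ := by
          rw [norm_div, div_mul_cancel₀ _ hwpos.ne']
  · intro j β hβ
    have hj : (1 : ℝ) ≤ (j : ℝ) + 1 := by linarith [(Nat.cast_nonneg j : (0 : ℝ) ≤ j)]
    have hlp : c * π * (j + 1) ≤ ‖w (β + 2 * π * (j + 1))‖ := by
      refine le_trans ?_ (hlow _)
      rw [mul_assoc]
      gcongr
      refine le_trans ?_ (le_abs_self _)
      nlinarith [hβ.1]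
    have hlm : c * π * (j + 1) ≤ ‖w (β - 2 * π * (j + 1))‖ := by
      refine le_trans ?_ (hlow _)
      rw [mul_assoc]
      gcongr
      refine le_trans ?_ (neg_le_abs _)
      nlinarith [hβ.2]
    have hpos : 0 < c * π * ((j : ℝ) + 1) := by positivity
    have n1 := norm_pos_iff.1 (hpos.trans_le hlp)
    have n2 := norm_pos_iff.1 (hpos.trans_le hlm)
    rw [← Complex.add_im]
    refine (Complex.abs_im_le_norm _).trans ?_
    have e : deriv x α / w (β + 2 * π * (j + 1)) + deriv x α / w (β - 2 * π * (j + 1)) =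
        deriv x α * (2 * w β / (w (β + 2 * π * (j + 1)) * w (β - 2 * π * (j + 1)))) := by
      have e2 : 2 * w β = w (β + 2 * π * (j + 1)) + w (β - 2 * π * (j + 1)) := by
        rw [hplus, hminus]; ring
      rw [e2]
      field_simp
      ring
    rw [e, norm_mul, norm_div, norm_mul, norm_mul, Complex.norm_two, mul_div_assoc ‖deriv x α‖]
    refine mul_le_mul_of_nonneg_left ?_ (norm_nonneg _)
    rw [div_div]
    have e3 : (c * π) ^ 2 * ((j : ℝ) + 1) ^ 2 = (c * π * (j + 1)) * (c * π * (j + 1)) := by ring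
    rw [e3]
    gcongr
    exact hMw β ⟨hβ.1.le, hβ.2⟩
  · intro β hβ hβ0
    -- For `0 ≠ β ∈ (-π, π]` no shift `β + 2πm` vanishes, so the lower bound keeps `w` off the poles
    -- of the cotangent.
    have hne : ∀ m : ℤ, w β + 2 * π * m ≠ 0 := by
      have hβm (m : ℤ) : β + 2 * π * m ≠ 0 := by
        intro h
        rcases lt_trichotomy m 0 with hm | hm | hm
        · have : (m : ℝ) ≤ -1 := by exact_mod_cast Int.le_sub_one_of_lt hm
          nlinarith [hβ.2]
        · rw [hm] at h
          simp at h
          exact hβ0 h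
        · have : (1 : ℝ) ≤ m := by exact_mod_cast hm
          nlinarith [hβ.1]
      intro m
      have hwm : w (β + 2 * π * m) = w β + 2 * π * m := by
        obtain ⟨j, rfl | rfl⟩ := m.eq_nat_or_neg
        · exact_mod_cast hshiftN j β
        · have := hshiftN' j β
          push_cast
          rw [mul_neg, mul_neg, ← sub_eq_add_neg, ← sub_eq_add_neg]
          exact this
      rw [← hwm]
      have hpos : 0 < c * |β + 2 * π * m| := mul_pos hc (abs_pos.2 (hβm m))
      exact norm_pos_iff.1 (hpos.trans_le (hlow _))
    have h1 := Complex.hasSum_im ((hasSum_halfCot hne).mul_left (deriv x α))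
    convert h1 using 1
    · funext j
      change (deriv x α / w (β + 2 * π * (j + 1))).im + (deriv x α / w (β - 2 * π * (j + 1))).im = _
      rw [hplus, hminus, mul_add (deriv x α), Complex.add_im, mul_one_div, mul_one_div]
    · rw [mul_sub, Complex.sub_im, mul_one_div]

/-! ### Estimates for the periodized kernel -/

/-- The derivative `-1 / (4 sin²(w/2))` of `halfCot`. -/
noncomputable def halfCotDeriv (w : ℂ) : ℂ := -1 / (4 * Complex.sin (w / 2) ^ 2)

theorem hasDerivAt_halfCot {w : ℂ} (hw : Complex.sin (w / 2) ≠ 0) :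
    HasDerivAt halfCot (halfCotDeriv w) w := by
  have h1 : HasDerivAt (fun v : ℂ => v / 2) (1 / 2) w := (hasDerivAt_id w).div_const 2
  have hs := h1.csin
  have hc := h1.ccos
  have h2 := (hc.div hs hw).div_const 2
  have hfun : halfCot = fun v => Complex.cos (v / 2) / Complex.sin (v / 2) / 2 := by
    funext v
    rw [halfCot, Complex.cot_eq_cos_div_sin]
  rw [hfun]
  refine h2.congr_deriv ?_
  rw [halfCotDeriv]
  field_simp
  linear_combination (-4) * Complex.sin_sq_add_cos_sq (w / 2)

theorem sq_norm_sin (v : ℂ) :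
    ‖Complex.sin v‖ ^ 2 = Real.sin v.re ^ 2 + Real.sinh v.im ^ 2 := by
  rw [← Complex.normSq_eq_norm_sq, Complex.sin_eq v, Complex.normSq_apply]
  simp only [← Complex.ofReal_sin, ← Complex.ofReal_cos, ← Complex.ofReal_sinh,
    ← Complex.ofReal_cosh, Complex.add_re, Complex.add_im, Complex.mul_re, Complex.mul_im,
    Complex.ofReal_re, Complex.ofReal_im, Complex.I_re, Complex.I_im]
  have h1 := Real.sin_sq_add_cos_sq v.re
  have h2 := Real.cosh_sq v.im
  ring_nf
  rw [h2]
  linear_combination (Real.sinh v.im ^ 2) * h1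

/-- With `|sin(a+ib)|² = sin²a + sinh²b`, Jordan's inequality handles the real part and `sinh t ≥ t`
the imaginary part, the latter with room to spare since `π ≥ 2`. -/
theorem norm_le_pi_mul_norm_sin {w : ℂ} (hw : |w.re| ≤ π) :
    ‖w‖ ≤ π * ‖Complex.sin (w / 2)‖ := by
  have hπ := Real.pi_pos
  refine abs_le_of_sq_le_sq' ?_ (by positivity) |>.2
  rw [mul_pow, sq_norm_sin, ← Complex.normSq_eq_norm_sq, Complex.normSq_apply]
  have hre : (w / 2).re = w.re / 2 := by simp
  have him : (w / 2).im = w.im / 2 := by simp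
  rw [hre, him]
  have h1 : (2 / π * |w.re / 2|) ^ 2 ≤ Real.sin (w.re / 2) ^ 2 := by
    rw [← sq_abs (Real.sin (w.re / 2))]
    have := Real.mul_abs_le_abs_sin (x := w.re / 2) (by rw [abs_div, abs_two]; linarith)
    gcongr
  have h2 : |w.im / 2| ^ 2 ≤ Real.sinh (w.im / 2) ^ 2 := by
    rw [← sq_abs (Real.sinh _), Real.abs_sinh]
    gcongr
    exact Real.self_le_sinh_iff.2 (abs_nonneg _)
  rw [mul_pow, sq_abs] at h1
  rw [sq_abs] at h2
  have h3 : π ^ 2 * ((2 / π) ^ 2 * (w.re / 2) ^ 2) = w.re ^ 2 := by field_simp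
  have h4 : (2 : ℝ) ^ 2 ≤ π ^ 2 := by
    have := Real.two_le_pi
    gcongr
  have h5 : (0 : ℝ) ≤ π ^ 2 := by positivity
  nlinarith [mul_le_mul_of_nonneg_left h1 h5, mul_le_mul_of_nonneg_left h2 h5,
    mul_le_mul_of_nonneg_right h4 (sq_nonneg (w.im / 2))]

theorem exists_abs_re_add_le (w : ℂ) : ∃ m : ℤ, |(w + 2 * π * m).re| ≤ π := by
  have hπ := Real.pi_pos
  refine ⟨-round (w.re / (2 * π)), ?_⟩
  have h := abs_sub_round (w.re / (2 * π))
  have e : (w + 2 * π * ((-round (w.re / (2 * π)) : ℤ) : ℂ)).re =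
      2 * π * (w.re / (2 * π) - round (w.re / (2 * π))) := by
    have e1 : (2 * π * ((-round (w.re / (2 * π)) : ℤ) : ℂ)) =
        ((2 * π * ((-round (w.re / (2 * π)) : ℤ) : ℝ) : ℝ) : ℂ) := by push_cast; ring
    rw [Complex.add_re, e1, Complex.ofReal_re]
    push_cast
    field_simp
    ring
  rw [e, abs_mul, abs_of_pos (by positivity : 0 < 2 * π)]
  nlinarith

theorem norm_sin_add_int (w : ℂ) (m : ℤ) :
    ‖Complex.sin ((w + 2 * π * m) / 2)‖ = ‖Complex.sin (w / 2)‖ := by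
  have e : (w + 2 * π * m) / 2 = w / 2 + m * π := by ring
  rw [e, Complex.sin_add, Complex.sin_int_mul_pi, mul_zero, add_zero, norm_mul]
  have h : ‖Complex.cos (m * π)‖ = 1 := by
    have := Complex.sin_sq_add_cos_sq ((m : ℂ) * π)
    rw [Complex.sin_int_mul_pi] at this
    have h2 : ‖Complex.cos (m * π)‖ ^ 2 = 1 := by
      rw [← norm_pow, show Complex.cos (m * π) ^ 2 = 1 by linear_combination this, norm_one]
    nlinarith [norm_nonneg (Complex.cos (m * π))]
  rw [h, mul_one]

/-- Both sides are insensitive to shifts by `2π`, so `w` can be moved into the strip `|Re w| ≤ π`.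
-/
theorem le_pi_mul_norm_sin {w : ℂ} {ρ : ℝ} (hw : ∀ m : ℤ, ρ ≤ ‖w + 2 * π * m‖) :
    ρ ≤ π * ‖Complex.sin (w / 2)‖ := by
  obtain ⟨m, hm⟩ := exists_abs_re_add_le w
  rw [← norm_sin_add_int w m]
  exact (hw m).trans (norm_le_pi_mul_norm_sin hm)

/-- From `|cos| ≤ 1 + |sin|`; the condition `ρ ≤ 1` absorbs the part of the cotangent that stays
bounded away from the poles. -/
theorem norm_halfCot_le {w : ℂ} {ρ : ℝ} (hρ : 0 < ρ) (hρ1 : ρ ≤ 1)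
    (hw : ∀ m : ℤ, ρ ≤ ‖w + 2 * π * m‖) : ‖halfCot w‖ ≤ 3 / ρ := by
  have hπ := Real.pi_pos
  have h1 := le_pi_mul_norm_sin hw
  have hs : 0 < ‖Complex.sin (w / 2)‖ := by
    by_contra hcon
    nlinarith [norm_nonneg (Complex.sin (w / 2))]
  have hcos : ‖Complex.cos (w / 2)‖ ≤ 1 + ‖Complex.sin (w / 2)‖ := by
    have h2 : ‖Complex.cos (w / 2)‖ ^ 2 ≤ 1 + ‖Complex.sin (w / 2)‖ ^ 2 := by
      rw [← norm_pow, ← norm_pow]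
      have : Complex.cos (w / 2) ^ 2 = 1 - Complex.sin (w / 2) ^ 2 := by
        linear_combination Complex.sin_sq_add_cos_sq (w / 2)
      rw [this]
      refine (norm_sub_le _ _).trans ?_
      rw [norm_one]
    nlinarith [norm_nonneg (Complex.cos (w / 2))]
  rw [halfCot, Complex.cot_eq_cos_div_sin, norm_div, norm_div, Complex.norm_two, div_div,
    div_le_div_iff₀ (by positivity) hρ]
  nlinarith [Real.pi_lt_four]

theorem norm_halfCotDeriv_le {w : ℂ} {ρ : ℝ} (hρ : 0 < ρ)
    (hw : ∀ m : ℤ, ρ ≤ ‖w + 2 * π * m‖) : ‖halfCotDeriv w‖ ≤ 3 / ρ ^ 2 := by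
  have hπ := Real.pi_pos
  have h1 := le_pi_mul_norm_sin hw
  have hs : 0 < ‖Complex.sin (w / 2)‖ := by
    by_contra hcon
    nlinarith [norm_nonneg (Complex.sin (w / 2))]
  rw [halfCotDeriv, norm_div, norm_neg, norm_one, norm_mul, norm_pow,
    show ‖(4 : ℂ)‖ = 4 by simp, div_le_div_iff₀ (by positivity) (by positivity), one_mul]
  have h2 : ρ ^ 2 ≤ (π * ‖Complex.sin (w / 2)‖) ^ 2 := by gcongr
  have h3 : π ^ 2 ≤ 12 := by nlinarith [Real.pi_lt_d2]
  nlinarith [sq_nonneg ‖Complex.sin (w / 2)‖]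

/-- Subtract the second-order Taylor bounds of `exp` at `±iv`: the even terms cancel, leaving a
cubic remainder. -/
theorem norm_sin_sub_le {v : ℂ} (hv : ‖v‖ ≤ 1) : ‖Complex.sin v - v‖ ≤ ‖v‖ ^ 3 := by
  have h1 := Complex.exp_bound (x := v * Complex.I) (n := 3) (by simpa using hv) (by norm_num)
  have h2 := Complex.exp_bound (x := -v * Complex.I) (n := 3) (by simpa using hv) (by norm_num)
  simp only [Finset.sum_range_succ, Finset.sum_range_zero, norm_mul, norm_neg, Complex.norm_I,
    mul_one] at h1 h2
  norm_num [Nat.factorial] at h1 h2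
  have e : Complex.sin v - v = ((Complex.exp (-(v * Complex.I)) -
      (1 + -(v * Complex.I) + (v * Complex.I) ^ 2 / 2)) -
      (Complex.exp (v * Complex.I) - (1 + v * Complex.I + (v * Complex.I) ^ 2 / 2))) *
      (Complex.I / 2) := by
    rw [Complex.sin, neg_mul]
    linear_combination -v * Complex.I_sq
  rw [e, norm_mul, norm_div, Complex.norm_I, Complex.norm_two]
  have := norm_sub_le (Complex.exp (-(v * Complex.I)) -
      (1 + -(v * Complex.I) + (v * Complex.I) ^ 2 / 2))
      (Complex.exp (v * Complex.I) - (1 + v * Complex.I + (v * Complex.I) ^ 2 / 2))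
  nlinarith [pow_nonneg (norm_nonneg v) 3]

theorem norm_cos_sub_one_le {v : ℂ} (hv : ‖v‖ ≤ 1) : ‖Complex.cos v - 1‖ ≤ ‖v‖ ^ 2 := by
  have h1 := Complex.norm_exp_sub_one_sub_id_le (x := v * Complex.I) (by simpa using hv)
  have h2 := Complex.norm_exp_sub_one_sub_id_le (x := -v * Complex.I) (by simpa using hv)
  simp only [norm_mul, norm_neg, Complex.norm_I, mul_one] at h1 h2
  have e : Complex.cos v - 1 = ((Complex.exp (v * Complex.I) - 1 - v * Complex.I) +
      (Complex.exp (-v * Complex.I) - 1 - -v * Complex.I)) / 2 := by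
    rw [Complex.cos]; ring
  rw [e, norm_div, Complex.norm_two]
  have := norm_add_le (Complex.exp (v * Complex.I) - 1 - v * Complex.I)
    (Complex.exp (-v * Complex.I) - 1 - -v * Complex.I)
  linarith

/-! ### The cotangent near its pole at the origin. -/

section Small

variable {w : ℂ}

theorem sin_half_ne_zero (hw0 : w ≠ 0) (hw : ‖w‖ ≤ 1) : Complex.sin (w / 2) ≠ 0 := by
  have h := norm_le_pi_mul_norm_sin (w := w)
    ((Complex.abs_re_le_norm w).trans (hw.trans (by linarith [Real.pi_gt_three])))
  intro h0
  rw [h0, norm_zero, mul_zero] at h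
  exact hw0 (norm_le_zero_iff.1 h)

theorem norm_two_mul_sin_sub_le (hw : ‖w‖ ≤ 1) :
    ‖2 * Complex.sin (w / 2) - w‖ ≤ ‖w‖ ^ 3 / 4 := by
  have hv : ‖w / 2‖ = ‖w‖ / 2 := by rw [norm_div, Complex.norm_two]
  have h := norm_sin_sub_le (v := w / 2) (by rw [hv]; linarith)
  have e : 2 * Complex.sin (w / 2) - w = 2 * (Complex.sin (w / 2) - w / 2) := by ring
  rw [e, norm_mul, Complex.norm_two]
  rw [hv] at h
  linarith

theorem norm_halfCot_sub_inv_le_of_norm_le_one (hw0 : w ≠ 0) (hw : ‖w‖ ≤ 1) :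
    ‖halfCot w - 1 / w‖ ≤ 2 * ‖w‖ := by
  have hwp : 0 < ‖w‖ := norm_pos_iff.2 hw0
  have hv : ‖w / 2‖ = ‖w‖ / 2 := by rw [norm_div, Complex.norm_two]
  have hsl := norm_le_pi_mul_norm_sin (w := w)
    ((Complex.abs_re_le_norm w).trans (hw.trans (by linarith [Real.pi_gt_three])))
  have hs := sin_half_ne_zero hw0 hw
  have hsp : 0 < ‖Complex.sin (w / 2)‖ := norm_pos_iff.2 hs
  have h1 := norm_two_mul_sin_sub_le hw
  have h2 := norm_cos_sub_one_le (v := w / 2) (by rw [hv]; linarith)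
  rw [hv] at h2
  -- Over the common denominator the numerator is cubic in `w` and the denominator quadratic.
  have e : halfCot w - 1 / w = (w * (Complex.cos (w / 2) - 1) -
      (2 * Complex.sin (w / 2) - w)) / (2 * w * Complex.sin (w / 2)) := by
    rw [halfCot, Complex.cot_eq_cos_div_sin]
    field_simp
    ring
  rw [e, norm_div, norm_mul, norm_mul, Complex.norm_two, div_le_iff₀ (by positivity)]
  calc ‖w * (Complex.cos (w / 2) - 1) - (2 * Complex.sin (w / 2) - w)‖
      ≤ ‖w‖ * (‖w‖ / 2) ^ 2 + ‖w‖ ^ 3 / 4 := by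
        refine (norm_sub_le _ _).trans ?_
        rw [norm_mul]
        gcongr
    _ = ‖w‖ ^ 2 * ‖w‖ / 2 := by ring
    _ ≤ ‖w‖ ^ 2 * (4 * ‖Complex.sin (w / 2)‖) / 2 := by
        gcongr
        exact hsl.trans (by gcongr; exact Real.pi_lt_four.le)
    _ ≤ 2 * ‖w‖ * (2 * ‖w‖ * ‖Complex.sin (w / 2)‖) := by
        nlinarith [mul_pos (pow_pos hwp 2) hsp]

theorem norm_halfCotDeriv_add_le_of_norm_le_one (hw0 : w ≠ 0) (hw : ‖w‖ ≤ 1) :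
    ‖halfCotDeriv w + 1 / w ^ 2‖ ≤ 4 := by
  have hwp : 0 < ‖w‖ := norm_pos_iff.2 hw0
  have hsl := norm_le_pi_mul_norm_sin (w := w)
    ((Complex.abs_re_le_norm w).trans (hw.trans (by linarith [Real.pi_gt_three])))
  have hs := sin_half_ne_zero hw0 hw
  have hsp : 0 < ‖Complex.sin (w / 2)‖ := norm_pos_iff.2 hs
  have h1 := norm_two_mul_sin_sub_le hw
  -- The numerator is the difference of squares `(2 sin(w/2))² - w²`, of fourth order like the
  -- denominator.
  have e : halfCotDeriv w + 1 / w ^ 2 = ((2 * Complex.sin (w / 2) - w) *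
      ((2 * Complex.sin (w / 2) - w) + 2 * w)) / (4 * w ^ 2 * Complex.sin (w / 2) ^ 2) := by
    rw [halfCotDeriv]
    field_simp
    ring
  have h4 : ‖(4 : ℂ)‖ = 4 := by simp
  rw [e, norm_div, norm_mul, norm_mul, norm_mul, norm_pow, norm_pow, h4,
    div_le_iff₀ (by positivity)]
  have h3 : ‖w‖ ^ 3 ≤ ‖w‖ := by
    calc ‖w‖ ^ 3 = ‖w‖ * ‖w‖ ^ 2 := by ring
      _ ≤ ‖w‖ * 1 ^ 2 := by gcongr
      _ = ‖w‖ := by ring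
  have hsl4 : ‖w‖ ≤ 4 * ‖Complex.sin (w / 2)‖ :=
    hsl.trans (by gcongr; exact Real.pi_lt_four.le)
  calc ‖2 * Complex.sin (w / 2) - w‖ * ‖2 * Complex.sin (w / 2) - w + 2 * w‖
      ≤ (‖w‖ ^ 3 / 4) * (3 * ‖w‖) := by
        gcongr
        refine (norm_add_le _ _).trans ?_
        rw [norm_mul, Complex.norm_two]
        linarith
    _ = 3 / 4 * (‖w‖ ^ 2 * ‖w‖ ^ 2) := by ring
    _ ≤ 3 / 4 * (‖w‖ ^ 2 * (4 * ‖Complex.sin (w / 2)‖) ^ 2) := by gcongr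
    _ ≤ 4 * (4 * ‖w‖ ^ 2 * ‖Complex.sin (w / 2)‖ ^ 2) := by
        nlinarith [mul_pos (pow_pos hwp 2) (pow_pos hsp 2)]

end Small

/-- With the pole at `0` subtracted, only the distance to the other lattice points matters. If `|w|
≥ 1`, the origin is itself at distance at least `ρ` and the unsubtracted bound suffices. -/
theorem norm_halfCot_sub_inv_le {w : ℂ} (hw0 : w ≠ 0) {ρ : ℝ} (hρ : 0 < ρ) (hρ1 : ρ ≤ 1)
    (hw : ∀ m : ℤ, m ≠ 0 → ρ ≤ ‖w + 2 * π * m‖) : ‖halfCot w - 1 / w‖ ≤ 4 / ρ := by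
  have h1ρ : 1 ≤ 1 / ρ := (one_le_div hρ).2 hρ1
  rcases le_total ‖w‖ 1 with h | h
  · refine (norm_halfCot_sub_inv_le_of_norm_le_one hw0 h).trans ?_
    have : 4 / ρ = 4 * (1 / ρ) := by ring
    rw [this]
    linarith
  · have hall : ∀ m : ℤ, ρ ≤ ‖w + 2 * π * m‖ := by
      intro m
      rcases eq_or_ne m 0 with rfl | hm
      · simpa using hρ1.trans h
      · exact hw m hm
    refine (norm_sub_le _ _).trans ?_
    have h2 : ‖1 / w‖ ≤ 1 := by
      rw [norm_div, norm_one]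
      exact (div_le_one (by linarith)).2 h
    have h3 := norm_halfCot_le hρ hρ1 hall
    have e3 : 3 / ρ = 3 * (1 / ρ) := by ring
    have e4 : 4 / ρ = 4 * (1 / ρ) := by ring
    rw [e3] at h3
    rw [e4]
    linarith

theorem norm_halfCotDeriv_add_le {w : ℂ} (hw0 : w ≠ 0) {ρ : ℝ} (hρ : 0 < ρ) (hρ1 : ρ ≤ 1)
    (hw : ∀ m : ℤ, m ≠ 0 → ρ ≤ ‖w + 2 * π * m‖) : ‖halfCotDeriv w + 1 / w ^ 2‖ ≤ 4 / ρ ^ 2 := by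
  have h1ρ : 1 ≤ 1 / ρ ^ 2 := (one_le_div (by positivity)).2 (by nlinarith)
  have e4 : 4 / ρ ^ 2 = 4 * (1 / ρ ^ 2) := by ring
  rw [e4]
  rcases le_total ‖w‖ 1 with h | h
  · refine (norm_halfCotDeriv_add_le_of_norm_le_one hw0 h).trans ?_
    linarith
  · have hall : ∀ m : ℤ, ρ ≤ ‖w + 2 * π * m‖ := by
      intro m
      rcases eq_or_ne m 0 with rfl | hm
      · simpa using hρ1.trans h
      · exact hw m hm
    refine (norm_add_le _ _).trans ?_
    have h2 : ‖1 / w ^ 2‖ ≤ 1 := by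
      rw [norm_div, norm_one, norm_pow]
      exact (div_le_one (by positivity)).2 (one_le_pow₀ h)
    have h3 := norm_halfCotDeriv_le hρ hall
    have e3 : 3 / ρ ^ 2 = 3 * (1 / ρ ^ 2) := by ring
    rw [e3] at h3
    linarith

theorem halfCot_add_two_pi (w : ℂ) : halfCot (w + 2 * π) = halfCot w := by
  have e : (w + 2 * π) / 2 = w / 2 + π := by ring
  rw [halfCot, halfCot, Complex.cot_eq_cos_div_sin, Complex.cot_eq_cos_div_sin, e,
    Complex.sin_add_pi, Complex.cos_add_pi, neg_div_neg_eq]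

theorem halfCotDeriv_add_two_pi (w : ℂ) : halfCotDeriv (w + 2 * π) = halfCotDeriv w := by
  have e : (w + 2 * π) / 2 = w / 2 + π := by ring
  rw [halfCotDeriv, halfCotDeriv, e, Complex.sin_add_pi, neg_sq]

/-! ### Quantitative bounds for a curve -/

/-- A horizontally periodic `C^{2,δ}` curve all of whose derivative norms are at most `N`. -/
structure IsCurveBound (δ : ℝ) (z : ℝ → ℂ) (N : ℝ) : Prop where
  periodic : ∀ α, z (α + 2 * π) = z α + 2 * π
  hasDerivAt : ∀ α, HasDerivAt z (deriv z α) α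
  hasDerivAt_deriv : ∀ α, HasDerivAt (deriv z) (deriv (deriv z) α) α
  continuous_deriv_deriv : Continuous (deriv (deriv z))
  one_le : 1 ≤ N
  norm_deriv_le : ∀ α, ‖deriv z α‖ ≤ N
  norm_deriv_deriv_le : ∀ α, ‖deriv (deriv z) α‖ ≤ N
  holder : ∀ α γ, ‖deriv (deriv z) α - deriv (deriv z) γ‖ ≤ N * |α - γ| ^ δ

theorem deriv_periodic_of_add_const {f : ℝ → ℂ} {p : ℝ} {c : ℂ} (h : ∀ α, f (α + p) = f α + c) :
    Function.Periodic (deriv f) p := by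
  intro α
  rw [← deriv_comp_add_const, funext h, deriv_add_const]

theorem IsC2HolderCurve.isCurveBound {δ : ℝ≥0} {z : ℝ → ℂ} (hz : IsC2HolderCurve δ z) :
    IsCurveBound δ z (c2HolderNorm δ z).toReal := by
  have hd0 : Differentiable ℝ z := hz.contDiff.differentiable (by norm_num)
  have hcd1 : ContDiff ℝ 1 (deriv z) := by
    have h2 : ContDiff ℝ (1 + 1) z := by
      have := hz.contDiff
      norm_num
      exact this
    exact (contDiff_succ_iff_deriv.1 h2).2.2
  have hd1 : Differentiable ℝ (deriv z) := hcd1.differentiable (by norm_num)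
  have hc2 : Continuous (deriv (deriv z)) := (contDiff_one_iff_deriv.1 hcd1).2
  have hp1 : Function.Periodic (deriv z) (2 * π) := deriv_periodic_of_add_const hz.periodic
  have hp2 : Function.Periodic (deriv (deriv z)) (2 * π) :=
    deriv_periodic_of_add_const (c := 0) fun α => by rw [hp1 α, add_zero]
  have hsup {f : ℝ → ℂ} (hf : Continuous f) (hp : Function.Periodic f (2 * π)) :
      (⨆ α, ‖f α‖ₑ) ≠ ⊤ := by
    obtain ⟨M, hM⟩ := (hp.isBounded_of_continuous Real.two_pi_pos.ne' hf).exists_norm_le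
    refine ne_top_of_le_ne_top (ENNReal.ofReal_ne_top (r := M)) (iSup_le fun α => ?_)
    rw [← ofReal_norm]
    exact ENNReal.ofReal_le_ofReal (hM _ ⟨α, rfl⟩)
  have hsup0 : (⨆ α ∈ Set.Icc (-π) π, ‖z α‖ₑ) ≠ ⊤ := by
    obtain ⟨M, hM⟩ := (isCompact_Icc (a := -π) (b := π)).exists_bound_of_continuousOn
      hd0.continuous.continuousOn
    refine ne_top_of_le_ne_top (ENNReal.ofReal_ne_top (r := M)) (iSup₂_le fun α hα => ?_)
    rw [← ofReal_norm]
    exact ENNReal.ofReal_le_ofReal (hM _ hα)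
  -- Needed because `toReal` sends `⊤` to `0`.
  have hfin : c2HolderNorm δ z ≠ ⊤ := by
    unfold c2HolderNorm
    refine ENNReal.add_ne_top.2 ⟨ENNReal.add_ne_top.2 ⟨ENNReal.add_ne_top.2 ⟨hsup0,
      hsup hd1.continuous hp1⟩, hsup hc2 hp2⟩, ?_⟩
    rw [← hz.holder.coe_nnHolderNorm_eq_eHolderNorm]
    exact ENNReal.coe_ne_top
  have hnorm {x : ℂ} (hx : ‖x‖ₑ ≤ c2HolderNorm δ z) : ‖x‖ ≤ (c2HolderNorm δ z).toReal := by
    rw [← toReal_enorm]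
    exact ENNReal.toReal_mono hfin hx
  have hb1 (α : ℝ) : ‖deriv z α‖ ≤ (c2HolderNorm δ z).toReal := by
    refine hnorm ((le_iSup (fun α => ‖deriv z α‖ₑ) α).trans ?_)
    unfold c2HolderNorm
    exact le_add_right (le_add_right le_add_self)
  refine ⟨hz.periodic, fun α => (hd0 α).hasDerivAt, fun α => (hd1 α).hasDerivAt, hc2, ?_, hb1,
    fun α => ?_, fun α γ => ?_⟩
  -- The curve advances by `2π` over a parameter interval of length `2π`, so its speed bound is at
  -- least `1`.
  · have h1 := Convex.norm_image_sub_le_of_norm_deriv_le (𝕜 := ℝ) (s := Set.univ) (f := z)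
      (fun x _ => hd0 x) (fun x _ => hb1 x) convex_univ (Set.mem_univ 0) (Set.mem_univ (0 + 2 * π))
    rw [hz.periodic, add_sub_cancel_left, add_sub_cancel_left] at h1
    have e : ‖(2 * π : ℂ)‖ = 2 * π := by
      rw [norm_mul, Complex.norm_two, Complex.norm_real, Real.norm_of_nonneg Real.pi_pos.le]
    rw [e, Real.norm_of_nonneg Real.two_pi_pos.le] at h1
    nlinarith [Real.two_pi_pos]
  · refine hnorm ((le_iSup (fun α => ‖deriv (deriv z) α‖ₑ) α).trans ?_)
    unfold c2HolderNorm
    exact le_add_right le_add_self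
  · have h1 := hz.holder.holderWith.dist_le α γ
    rw [dist_eq_norm, Real.dist_eq] at h1
    refine h1.trans ?_
    gcongr
    rw [← ENNReal.coe_toReal]
    refine ENNReal.toReal_mono hfin ?_
    rw [hz.holder.coe_nnHolderNorm_eq_eHolderNorm]
    unfold c2HolderNorm
    exact le_add_self

namespace IsCurveBound

variable {δ : ℝ} {z : ℝ → ℂ} {N : ℝ}

theorem continuous (h : IsCurveBound δ z N) : Continuous z :=
  continuous_iff_continuousAt.2 fun α => (h.hasDerivAt α).continuousAt

theorem continuous_deriv (h : IsCurveBound δ z N) : Continuous (deriv z) :=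
  continuous_iff_continuousAt.2 fun α => (h.hasDerivAt_deriv α).continuousAt

theorem nonneg (h : IsCurveBound δ z N) : 0 ≤ N := zero_le_one.trans h.one_le

theorem deriv_periodic (h : IsCurveBound δ z N) : Function.Periodic (deriv z) (2 * π) :=
  deriv_periodic_of_add_const h.periodic

theorem deriv_deriv_periodic (h : IsCurveBound δ z N) :
    Function.Periodic (deriv (deriv z)) (2 * π) :=
  deriv_periodic_of_add_const (c := 0) fun α => by rw [h.deriv_periodic α, add_zero]

theorem abs_sub_le_of_mem_uIcc {α γ s : ℝ} (hs : s ∈ Set.uIcc α γ) : |s - α| ≤ |α - γ| := by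
  rw [abs_sub_comm α γ]
  exact Set.abs_sub_left_of_mem_uIcc hs

theorem norm_deriv_sub_le (h : IsCurveBound δ z N) (α γ : ℝ) :
    ‖deriv z γ - deriv z α‖ ≤ N * |α - γ| := by
  have := Convex.norm_image_sub_le_of_norm_hasDerivWithin_le (s := Set.univ)
    (fun x _ => (h.hasDerivAt_deriv x).hasDerivWithinAt) (fun x _ => h.norm_deriv_deriv_le x)
    convex_univ (Set.mem_univ α) (Set.mem_univ γ)
  rwa [Real.norm_eq_abs, abs_sub_comm] at this

/-- First-order Taylor expansion. -/
theorem norm_taylor_one_le (h : IsCurveBound δ z N) (α γ : ℝ) :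
    ‖z α - z γ - deriv z α * ((α - γ : ℝ) : ℂ)‖ ≤ N * |α - γ| ^ 2 := by
  have hder (s : ℝ) : HasDerivAt (fun s : ℝ => z s - deriv z α * (s : ℂ))
      (deriv z s - deriv z α) s := by
    have := (h.hasDerivAt s).sub (((hasDerivAt_id s).ofReal_comp).const_mul (deriv z α))
    exact this.congr_deriv (by simp)
  have := Convex.norm_image_sub_le_of_norm_hasDerivWithin_le (s := Set.uIcc α γ)
    (C := N * |α - γ|) (fun x _ => (hder x).hasDerivWithinAt)
    (fun x hx => (h.norm_deriv_sub_le α x).trans (by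
      rw [abs_sub_comm]
      have := abs_sub_le_of_mem_uIcc hx
      have := h.nonneg
      gcongr))
    (convex_uIcc α γ) Set.right_mem_uIcc Set.left_mem_uIcc
  rw [Real.norm_eq_abs] at this
  calc ‖z α - z γ - deriv z α * ((α - γ : ℝ) : ℂ)‖
      = ‖z α - deriv z α * (α : ℂ) - (z γ - deriv z α * (γ : ℂ))‖ := by
        congr 1; push_cast; ring
    _ ≤ N * |α - γ| * |α - γ| := this
    _ = _ := by ring

theorem norm_deriv_taylor_le (h : IsCurveBound δ z N) (hδ : 0 < δ) (α γ : ℝ) :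
    ‖deriv z γ - deriv z α - deriv (deriv z) α * ((γ - α : ℝ) : ℂ)‖ ≤ N * |α - γ| ^ δ * |α - γ| := by
  have hder (s : ℝ) : HasDerivAt (fun s : ℝ => deriv z s - deriv (deriv z) α * (s : ℂ))
      (deriv (deriv z) s - deriv (deriv z) α) s := by
    have := (h.hasDerivAt_deriv s).sub
      (((hasDerivAt_id s).ofReal_comp).const_mul (deriv (deriv z) α))
    exact this.congr_deriv (by simp)
  have := Convex.norm_image_sub_le_of_norm_hasDerivWithin_le (s := Set.uIcc α γ)
    (C := N * |α - γ| ^ δ) (fun x _ => (hder x).hasDerivWithinAt)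
    (fun x hx => (h.holder x α).trans (by
      have := abs_sub_le_of_mem_uIcc hx
      have := h.nonneg
      gcongr))
    (convex_uIcc α γ) Set.left_mem_uIcc Set.right_mem_uIcc
  rw [Real.norm_eq_abs, abs_sub_comm γ α] at this
  refine le_trans (le_of_eq ?_) this
  congr 1
  push_cast
  ring

/-- Second-order Taylor expansion with Hölder remainder. -/
theorem norm_taylor_two_le (h : IsCurveBound δ z N) (hδ : 0 < δ) (α γ : ℝ) :
    ‖z α - z γ - deriv z α * ((α - γ : ℝ) : ℂ) + deriv (deriv z) α * ((α - γ : ℝ) : ℂ) ^ 2 / 2‖ ≤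
      N * |α - γ| ^ δ * |α - γ| ^ 2 := by
  -- The auxiliary function has as derivative the first-order Taylor remainder of `z'`, already
  -- controlled by the Hölder bound; the mean value inequality integrates it.
  have hder (s : ℝ) : HasDerivAt (fun s : ℝ => z s + deriv z α * ((α - s : ℝ) : ℂ) -
      deriv (deriv z) α * ((α - s : ℝ) : ℂ) ^ 2 / 2)
      (deriv z s - deriv z α - deriv (deriv z) α * ((s - α : ℝ) : ℂ)) s := by
    have h1 : HasDerivAt (fun s : ℝ => ((α - s : ℝ) : ℂ)) ((-1 : ℝ) : ℂ) s :=
      ((hasDerivAt_id s).const_sub α).ofReal_comp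
    have h2 := ((h.hasDerivAt s).add (h1.const_mul (deriv z α))).sub
      (((h1.pow 2).const_mul (deriv (deriv z) α)).div_const 2)
    refine h2.congr_deriv ?_
    push_cast
    ring
  have := Convex.norm_image_sub_le_of_norm_hasDerivWithin_le (s := Set.uIcc α γ)
    (C := N * |α - γ| ^ δ * |α - γ|) (fun x _ => (hder x).hasDerivWithinAt)
    (fun x hx => (h.norm_deriv_taylor_le hδ α x).trans (by
      rw [abs_sub_comm α x]
      have := abs_sub_le_of_mem_uIcc hx
      have := h.nonneg
      gcongr))
    (convex_uIcc α γ) Set.right_mem_uIcc Set.left_mem_uIcc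
  rw [Real.norm_eq_abs] at this
  refine le_trans (le_of_eq ?_) (this.trans (le_of_eq (by ring)))
  congr 1
  push_cast
  ring

end IsCurveBound

/-- The periodized tangential kernel. -/
noncomputable def kernel (x y : ℝ → ℂ) (α γ : ℝ) : ℝ :=
  (deriv x α * halfCot (x α - y γ)).im

/-- The derivative of `kernel x y` in its first variable. -/
noncomputable def kernelDeriv (x y : ℝ → ℂ) (α γ : ℝ) : ℝ :=
  (deriv (deriv x) α * halfCot (x α - y γ) + deriv x α ^ 2 * halfCotDeriv (x α - y γ)).im

/-! ### Kernels of separated curves. -/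

section TwoCurves

variable {δ : ℝ} {x y : ℝ → ℂ} {N : ℝ}

theorem add_int_of_periodic (hy : ∀ α, y (α + 2 * π) = y α + 2 * π) (γ : ℝ) (m : ℤ) :
    y (γ + 2 * π * m) = y γ + 2 * π * m := by
  have hper : Function.Periodic (fun s : ℝ => y s - (s : ℂ)) (2 * π) := by
    intro s
    simp only [hy]
    push_cast
    ring
  have := hper.int_mul m γ
  rw [mul_comm (m : ℝ)] at this
  push_cast at this
  linear_combination this

/-- Periodicity of `y` makes `x(α) - y(γ) + 2πm` another difference between points of the two
curves, so separation gives distance `1/s` from the whole pole lattice. The constant `9` is chosen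
to match the single-curve estimate. -/
theorem abs_kernel_le (hx : IsCurveBound δ x N) (hy : ∀ α, y (α + 2 * π) = y α + 2 * π) {s : ℝ}
    (hs : 1 ≤ s) (hsep : ∀ α γ, 1 ≤ s * ‖x α - y γ‖) (α γ : ℝ) :
    |kernel x y α γ| ≤ 9 * s ^ 2 * N ^ 2 ∧ |kernelDeriv x y α γ| ≤ 9 * s ^ 2 * N ^ 2 := by
  have hs0 : 0 < s := by linarith
  have hN := hx.one_le
  have hN0 := hx.nonneg
  have hall (m : ℤ) : 1 / s ≤ ‖x α - y γ + 2 * π * m‖ := by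
    have h1 := add_int_of_periodic hy γ (-m)
    have h2 := hsep α (γ + 2 * π * (-m : ℤ))
    rw [h1] at h2
    rw [div_le_iff₀ hs0, mul_comm]
    have e : x α - (y γ + 2 * π * ((-m : ℤ) : ℂ)) = x α - y γ + 2 * π * m := by push_cast; ring
    rwa [e] at h2
  have hc := norm_halfCot_le (by positivity) ((div_le_one hs0).2 hs) hall
  have hd := norm_halfCotDeriv_le (by positivity) hall
  have e1 : 3 / (1 / s) = 3 * s := by field_simp
  have e2 : 3 / (1 / s) ^ 2 = 3 * s ^ 2 := by field_simp
  rw [e1] at hc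
  rw [e2] at hd
  have hss : s ≤ s ^ 2 := by nlinarith
  have hNN : N ≤ N ^ 2 := by nlinarith
  have hmain : N * (3 * s) ≤ 3 * s ^ 2 * N ^ 2 := by
    calc N * (3 * s) ≤ N ^ 2 * (3 * s ^ 2) := by gcongr
      _ = _ := by ring
  have hpos : 0 ≤ s ^ 2 * N ^ 2 := by positivity
  constructor
  · refine (Complex.abs_im_le_norm _).trans ?_
    rw [norm_mul]
    calc _ ≤ N * (3 * s) := by gcongr; exact hx.norm_deriv_le α
      _ ≤ _ := by linarith
  · refine (Complex.abs_im_le_norm _).trans ((norm_add_le _ _).trans ?_)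
    rw [norm_mul, norm_mul, norm_pow]
    calc _ ≤ N * (3 * s) + N ^ 2 * (3 * s ^ 2) := by
          gcongr
          · exact hx.norm_deriv_deriv_le α
          · exact hx.norm_deriv_le α
      _ ≤ _ := by nlinarith

theorem sin_ne_zero_of_separated (hy : ∀ α, y (α + 2 * π) = y α + 2 * π) {α γ : ℝ}
    (hsep : ∀ m : ℤ, x α ≠ y (γ + 2 * π * m)) : Complex.sin ((x α - y γ) / 2) ≠ 0 := by
  intro h
  rw [Complex.sin_eq_zero_iff] at h
  obtain ⟨m, hm⟩ := h
  refine hsep m ?_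
  rw [add_int_of_periodic hy]
  linear_combination 2 * hm

theorem hasDerivAt_kernel (hx : IsCurveBound δ x N) {α γ : ℝ}
    (hsin : Complex.sin ((x α - y γ) / 2) ≠ 0) :
    HasDerivAt (fun s => kernel x y s γ) (kernelDeriv x y α γ) α := by
  have h1 : HasDerivAt (fun s => x s - y γ) (deriv x α) α := (hx.hasDerivAt α).sub_const _
  have h2 := (hx.hasDerivAt_deriv α).mul ((hasDerivAt_halfCot hsin).comp α h1)
  have h3 := Complex.imCLM.hasFDerivAt.comp_hasDerivAt α h2
  refine h3.congr_deriv ?_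
  simp only [kernelDeriv, Complex.imCLM_apply, Function.comp_apply]
  congr 1
  ring

theorem continuousAt_kernel (hx : IsCurveBound δ x N) (hy : Continuous y) {p : ℝ × ℝ}
    (hsin : Complex.sin ((x p.1 - y p.2) / 2) ≠ 0) :
    ContinuousAt (fun q : ℝ × ℝ => kernel x y q.1 q.2) p ∧
      ContinuousAt (fun q : ℝ × ℝ => kernelDeriv x y q.1 q.2) p := by
  have hw : ContinuousAt (fun q : ℝ × ℝ => x q.1 - y q.2) p :=
    ((hx.continuous.comp continuous_fst).sub (hy.comp continuous_snd)).continuousAt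
  have hc : ContinuousAt (fun q : ℝ × ℝ => halfCot (x q.1 - y q.2)) p :=
    ContinuousAt.comp (f := fun q : ℝ × ℝ => x q.1 - y q.2)
      (hasDerivAt_halfCot hsin).continuousAt hw
  have hd : ContinuousAt (fun q : ℝ × ℝ => halfCotDeriv (x q.1 - y q.2)) p := by
    unfold halfCotDeriv
    refine continuousAt_const.div ?_ (by simpa using hsin)
    exact continuousAt_const.mul
      ((Complex.continuous_sin.continuousAt.comp (hw.div_const 2)).pow 2)
  have h1 : ContinuousAt (fun q : ℝ × ℝ => deriv x q.1) p :=
    (hx.continuous_deriv.comp continuous_fst).continuousAt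
  have h2 : ContinuousAt (fun q : ℝ × ℝ => deriv (deriv x) q.1) p :=
    (hx.continuous_deriv_deriv.comp continuous_fst).continuousAt
  exact ⟨Complex.continuous_im.continuousAt.comp (h1.mul hc),
    Complex.continuous_im.continuousAt.comp ((h2.mul hc).add ((h1.pow 2).mul hd))⟩

end TwoCurves

/-! ### The self-interaction kernel near the diagonal. -/

section OneCurve

variable {δ : ℝ} {z : ℝ → ℂ} {N s : ℝ}

theorem ne_of_arcChord (harc : ∀ α γ, |α - γ| ≤ s * ‖z α - z γ‖) {α γ : ℝ} (h : α ≠ γ) :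
    z α - z γ ≠ 0 := by
  intro h0
  have := harc α γ
  rw [h0, norm_zero, mul_zero] at this
  exact h (sub_eq_zero.1 (abs_nonpos_iff.1 this))

theorem norm_inv_le_of_arcChord (harc : ∀ α γ, |α - γ| ≤ s * ‖z α - z γ‖) {α γ : ℝ}
    (h : α ≠ γ) : ‖z α - z γ‖⁻¹ ≤ s / |α - γ| := by
  have h1 : 0 < |α - γ| := abs_pos.2 (sub_ne_zero.2 h)
  have h2 : 0 < ‖z α - z γ‖ := norm_pos_iff.2 (ne_of_arcChord harc h)
  rw [inv_eq_one_div, div_le_div_iff₀ h2 h1, one_mul]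
  exact harc α γ

/-- The real singularity `1 / (α - γ)` does not contribute to the imaginary part. -/
theorem im_deriv_div_sub {α γ : ℝ} (h : α ≠ γ) (hne : z α - z γ ≠ 0) :
    (deriv z α / (z α - z γ)).im =
      (-((z α - z γ - deriv z α * ((α - γ : ℝ) : ℂ)) /
        (((α - γ : ℝ) : ℂ) * (z α - z γ)))).im := by
  have hb : ((α - γ : ℝ) : ℂ) ≠ 0 := Complex.ofReal_ne_zero.2 (sub_ne_zero.2 h)
  have e : deriv z α / (z α - z γ) = ((1 / (α - γ) : ℝ) : ℂ) +
      -((z α - z γ - deriv z α * ((α - γ : ℝ) : ℂ)) / (((α - γ : ℝ) : ℂ) * (z α - z γ))) := by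
    rw [Complex.ofReal_div, Complex.ofReal_one]
    field_simp
    ring
  rw [e, Complex.add_im, Complex.ofReal_im, zero_add]

/-- After the real singularity is dropped, the numerator is a first-order Taylor remainder,
quadratic in `α - γ`, matching the denominator under the arc-chord condition. -/
theorem abs_im_deriv_div_sub_le (hz : IsCurveBound δ z N)
    (harc : ∀ α γ, |α - γ| ≤ s * ‖z α - z γ‖) (hs : 0 ≤ s) (α γ : ℝ) :
    |(deriv z α / (z α - z γ)).im| ≤ N * s := by
  have hN0 := hz.nonneg
  rcases eq_or_ne α γ with rfl | h
  -- On the diagonal division by zero makes the quotient `0`.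
  · simp
    positivity
  have hne := ne_of_arcChord harc h
  have hb : 0 < |α - γ| := abs_pos.2 (sub_ne_zero.2 h)
  rw [im_deriv_div_sub h hne]
  refine (Complex.abs_im_le_norm _).trans ?_
  rw [norm_neg, norm_div, norm_mul, Complex.norm_real, Real.norm_eq_abs, div_eq_mul_inv, mul_inv]
  calc _ ≤ (N * |α - γ| ^ 2) * (|α - γ|⁻¹ * (s / |α - γ|)) := by
        gcongr
        · exact hz.norm_taylor_one_le α γ
        · exact norm_inv_le_of_arcChord harc h
    _ = N * s := by field_simp

/-- Writing `b = α - γ`, `D = z(α) - z(γ)` and `R₁`, `R₂` for the first- and second-order Taylor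
remainders, the expression is the real number `-1/b²` plus `2R₂/(b²D) - R₁²/(b²D²)`. The Hölder
bound on `R₂` gives the power `δ - 1`. -/
theorem abs_im_deriv_deriv_div_sub_le (hz : IsCurveBound δ z N) (hδ : 0 < δ)
    (harc : ∀ α γ, |α - γ| ≤ s * ‖z α - z γ‖) {α γ : ℝ} (h : α ≠ γ) :
    |(deriv (deriv z) α / (z α - z γ) - deriv z α ^ 2 / (z α - z γ) ^ 2).im| ≤
      2 * (N * s) * |α - γ| ^ (δ - 1) + (N * s) ^ 2 := by
  have hN0 := hz.nonneg
  have hne := ne_of_arcChord harc h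
  have hb : 0 < |α - γ| := abs_pos.2 (sub_ne_zero.2 h)
  have hbc : ((α - γ : ℝ) : ℂ) ≠ 0 := Complex.ofReal_ne_zero.2 (sub_ne_zero.2 h)
  have hinv := norm_inv_le_of_arcChord harc h
  have e : deriv (deriv z) α / (z α - z γ) - deriv z α ^ 2 / (z α - z γ) ^ 2 =
      ((-(1 / (α - γ) ^ 2) : ℝ) : ℂ) +
      (2 * (z α - z γ - deriv z α * ((α - γ : ℝ) : ℂ) +
          deriv (deriv z) α * ((α - γ : ℝ) : ℂ) ^ 2 / 2) /
            (((α - γ : ℝ) : ℂ) ^ 2 * (z α - z γ)) -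
        (z α - z γ - deriv z α * ((α - γ : ℝ) : ℂ)) ^ 2 /
          (((α - γ : ℝ) : ℂ) ^ 2 * (z α - z γ) ^ 2)) := by
    rw [Complex.ofReal_neg, Complex.ofReal_div, Complex.ofReal_one, Complex.ofReal_pow]
    generalize z α - z γ = D at *
    generalize ((α - γ : ℝ) : ℂ) = b at *
    field_simp
    ring
  rw [e, Complex.add_im, Complex.ofReal_im, zero_add]
  refine (Complex.abs_im_le_norm _).trans ((norm_sub_le _ _).trans (add_le_add ?_ ?_))
  · rw [norm_div, norm_mul, norm_mul, norm_pow, Complex.norm_two, Complex.norm_real,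
      Real.norm_eq_abs, div_eq_mul_inv, mul_inv]
    calc _ ≤ 2 * (N * |α - γ| ^ δ * |α - γ| ^ 2) * ((|α - γ| ^ 2)⁻¹ * (s / |α - γ|)) := by
          gcongr
          exact hz.norm_taylor_two_le hδ α γ
      _ = 2 * (N * s) * (|α - γ| ^ δ / |α - γ|) := by field_simp
      _ = _ := by rw [Real.rpow_sub_one hb.ne']
  · rw [norm_div, norm_mul, norm_pow, norm_pow, norm_pow, Complex.norm_real, Real.norm_eq_abs,
      div_eq_mul_inv, mul_inv, ← inv_pow ‖z α - z γ‖]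
    calc _ ≤ (N * |α - γ| ^ 2) ^ 2 * ((|α - γ| ^ 2)⁻¹ * (s / |α - γ|) ^ 2) := by
          gcongr
          exact hz.norm_taylor_one_le α γ
      _ = _ := by field_simp

/-- A nonzero shift compares the curve at parameters at least `2π - π ≥ 1` apart, where the
arc-chord condition applies. -/
theorem one_div_le_norm_add_int (hper : ∀ α, z (α + 2 * π) = z α + 2 * π)
    (harc : ∀ α γ, |α - γ| ≤ s * ‖z α - z γ‖) (hs : 1 ≤ s) {α γ : ℝ} (hαγ : |α - γ| ≤ π)
    {m : ℤ} (hm : m ≠ 0) : 1 / s ≤ ‖z α - z γ + 2 * π * m‖ := by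
  have hs0 : 0 < s := by linarith
  have h1 := add_int_of_periodic hper γ (-m)
  have h2 := harc α (γ + 2 * π * (-m : ℤ))
  rw [h1] at h2
  rw [div_le_iff₀ hs0, mul_comm]
  have e : z α - (z γ + 2 * π * ((-m : ℤ) : ℂ)) = z α - z γ + 2 * π * m := by push_cast; ring
  rw [e] at h2
  refine le_trans ?_ h2
  have hm1 : (1 : ℝ) ≤ |(m : ℝ)| := by exact_mod_cast Int.one_le_abs hm
  have e2 : α - (γ + 2 * π * ((-m : ℤ) : ℝ)) = 2 * π * m - -(α - γ) := by push_cast; ring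
  rw [e2]
  have h3 := abs_sub_abs_le_abs_sub (2 * π * (m : ℝ)) (-(α - γ))
  rw [abs_neg, abs_mul, abs_of_pos Real.two_pi_pos] at h3
  nlinarith [Real.pi_gt_three]

theorem abs_kernel_self_le (hz : IsCurveBound δ z N) (hδ : 0 < δ)
    (harc : ∀ α γ, |α - γ| ≤ s * ‖z α - z γ‖) (hs : 1 ≤ s) {α γ : ℝ} (hαγ : |α - γ| ≤ π)
    (h : α ≠ γ) :
    |kernel z z α γ| ≤ 9 * s ^ 2 * N ^ 2 ∧
      |kernelDeriv z z α γ| ≤ 9 * s ^ 2 * N ^ 2 * (1 + |α - γ| ^ (δ - 1)) := by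
  have hs0 : 0 < s := by linarith
  have hN := hz.one_le
  have hN0 := hz.nonneg
  have hne := ne_of_arcChord harc h
  have hall (m : ℤ) (hm : m ≠ 0) : 1 / s ≤ ‖z α - z γ + 2 * π * m‖ :=
    one_div_le_norm_add_int hz.periodic harc hs hαγ hm
  have hc := norm_halfCot_sub_inv_le hne (by positivity) ((div_le_one hs0).2 hs) hall
  have hd := norm_halfCotDeriv_add_le hne (by positivity) ((div_le_one hs0).2 hs) hall
  have e1 : 4 / (1 / s) = 4 * s := by field_simp
  have e2 : 4 / (1 / s) ^ 2 = 4 * s ^ 2 := by field_simp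
  rw [e1] at hc
  rw [e2] at hd
  have hNs1 : 1 ≤ N * s := by nlinarith
  have hNs : N * s ≤ s ^ 2 * N ^ 2 := by nlinarith
  have hp : 0 ≤ |α - γ| ^ (δ - 1) := by positivity
  constructor
  · have e : kernel z z α γ = (deriv z α / (z α - z γ)).im +
        (deriv z α * (halfCot (z α - z γ) - 1 / (z α - z γ))).im := by
      rw [kernel, ← Complex.add_im]
      congr 1
      ring
    rw [e]
    refine (abs_add_le _ _).trans ?_
    have h1 := abs_im_deriv_div_sub_le hz harc hs0.le α γ
    have h2 : |(deriv z α * (halfCot (z α - z γ) - 1 / (z α - z γ))).im| ≤ N * (4 * s) := by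
      refine (Complex.abs_im_le_norm _).trans ?_
      rw [norm_mul]
      gcongr
      exact hz.norm_deriv_le α
    nlinarith
  -- Polar part plus regular part: the terms of order `s²N²` are `1` from the former and `4 + 4`
  -- from the latter, whence `9`.
  · have e : kernelDeriv z z α γ =
        (deriv (deriv z) α / (z α - z γ) - deriv z α ^ 2 / (z α - z γ) ^ 2).im +
        (deriv (deriv z) α * (halfCot (z α - z γ) - 1 / (z α - z γ)) +
          deriv z α ^ 2 * (halfCotDeriv (z α - z γ) + 1 / (z α - z γ) ^ 2)).im := by
      rw [kernelDeriv, ← Complex.add_im]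
      congr 1
      ring
    rw [e]
    refine (abs_add_le _ _).trans ?_
    have h1 := abs_im_deriv_deriv_div_sub_le hz hδ harc h
    have h2 : |(deriv (deriv z) α * (halfCot (z α - z γ) - 1 / (z α - z γ)) +
          deriv z α ^ 2 * (halfCotDeriv (z α - z γ) + 1 / (z α - z γ) ^ 2)).im| ≤
        N * (4 * s) + N ^ 2 * (4 * s ^ 2) := by
      refine (Complex.abs_im_le_norm _).trans ((norm_add_le _ _).trans ?_)
      rw [norm_mul, norm_mul, norm_pow]
      gcongr
      · exact hz.norm_deriv_deriv_le α
      · exact hz.norm_deriv_le α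
    have h3 : N * s * |α - γ| ^ (δ - 1) ≤ s ^ 2 * N ^ 2 * |α - γ| ^ (δ - 1) := by gcongr
    have h4 : 0 ≤ s ^ 2 * N ^ 2 * |α - γ| ^ (δ - 1) := by positivity
    nlinarith

/-- The kernel has no jump on the diagonal. -/
theorem tendsto_kernel_self (hz : IsCurveBound δ z N) (hδ : 0 < δ)
    (harc : ∀ α γ, |α - γ| ≤ s * ‖z α - z γ‖) (γ : ℝ) :
    ∃ y, Tendsto (fun α => kernel z z α γ) (𝓝[≠] γ) (𝓝 y) := by
  have hzc : Tendsto (fun α => z α - z γ) (𝓝[≠] γ) (𝓝 0) := by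
    have := (hz.continuous.sub continuous_const : Continuous fun α => z α - z γ).tendsto γ
    simp only [Pi.sub_apply, sub_self] at this
    exact this.mono_left nhdsWithin_le_nhds
  have hne : ∀ᶠ α in 𝓝[≠] γ, α ≠ γ := self_mem_nhdsWithin
  have hd1 : Tendsto (deriv z) (𝓝[≠] γ) (𝓝 (deriv z γ)) :=
    (hz.continuous_deriv.tendsto γ).mono_left nhdsWithin_le_nhds
  have hd2 : Tendsto (deriv (deriv z)) (𝓝[≠] γ) (𝓝 (deriv (deriv z) γ)) :=
    (hz.continuous_deriv_deriv.tendsto γ).mono_left nhdsWithin_le_nhds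
  -- the regular part
  have hR : Tendsto (fun α => halfCot (z α - z γ) - 1 / (z α - z γ)) (𝓝[≠] γ) (𝓝 0) := by
    have hb : Tendsto (fun α => 2 * ‖z α - z γ‖) (𝓝[≠] γ) (𝓝 0) := by
      simpa using hzc.norm.const_mul 2
    refine squeeze_zero_norm' ?_ hb
    have hsmall : ∀ᶠ α in 𝓝[≠] γ, ‖z α - z γ‖ < 1 := by
      have := hzc.norm
      rw [norm_zero] at this
      exact this.eventually_lt_const one_pos
    filter_upwards [hsmall, hne] with α hα hαγ
    exact norm_halfCot_sub_inv_le_of_norm_le_one (ne_of_arcChord harc hαγ) hα.le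
  -- the singular part
  have hslope : Tendsto (fun α : ℝ => (z α - z γ) / ((α - γ : ℝ) : ℂ)) (𝓝[≠] γ)
      (𝓝 (deriv z γ)) := by
    have := hasDerivAt_iff_tendsto_slope.1 (hz.hasDerivAt γ)
    refine this.congr fun α => ?_
    rw [slope_def_module, Complex.real_smul, div_eq_inv_mul]
    push_cast
    rfl
  -- The difference quotients have norm at least `1/s`, hence so does their limit in substance; a
  -- zero limit is contradictory.
  have hz0 : deriv z γ ≠ 0 := by
    intro h0
    rw [h0] at hslope
    have h1 := hslope.norm.const_mul s
    rw [norm_zero, mul_zero] at h1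
    have h2 := h1.eventually_lt_const one_pos
    obtain ⟨α, hα, hαγ⟩ := (h2.and hne).exists
    have hb : 0 < |α - γ| := abs_pos.2 (sub_ne_zero.2 hαγ)
    rw [norm_div, Complex.norm_real, Real.norm_eq_abs, ← mul_div_assoc, div_lt_one hb] at hα
    exact absurd (harc α γ) (not_le.2 hα)
  have hrem : Tendsto (fun α : ℝ => (z α - z γ - deriv z α * ((α - γ : ℝ) : ℂ) +
      deriv (deriv z) α * ((α - γ : ℝ) : ℂ) ^ 2 / 2) / ((α - γ : ℝ) : ℂ) ^ 2) (𝓝[≠] γ) (𝓝 0) := by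
    have hb : Tendsto (fun α : ℝ => N * |α - γ| ^ δ) (𝓝[≠] γ) (𝓝 0) := by
      have hcont : Continuous fun α : ℝ => N * |α - γ| ^ δ :=
        continuous_const.mul ((continuous_id.sub continuous_const).abs.rpow_const
          fun _ => Or.inr hδ.le)
      have := hcont.tendsto γ
      simp only [sub_self, abs_zero, Real.zero_rpow hδ.ne', mul_zero] at this
      exact this.mono_left nhdsWithin_le_nhds
    refine squeeze_zero_norm' ?_ hb
    filter_upwards [hne] with α hαγ
    have hb : 0 < |α - γ| := abs_pos.2 (sub_ne_zero.2 hαγ)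
    rw [norm_div, norm_pow, Complex.norm_real, Real.norm_eq_abs, div_le_iff₀ (by positivity)]
    exact hz.norm_taylor_two_le hδ α γ
  -- The singular part equals `(z''/2 - R₂/b²) / (D/b)`, with limit `z''(γ) / (2 z'(γ))`.
  have hsing := ((hd2.div_const 2).sub hrem).div hslope hz0
  have htot := (Complex.continuous_im.tendsto _).comp (hsing.add (hd1.mul hR))
  refine ⟨_, htot.congr' ?_⟩
  filter_upwards [hne] with α hαγ
  have hD := ne_of_arcChord harc hαγ
  have hbc : ((α - γ : ℝ) : ℂ) ≠ 0 := Complex.ofReal_ne_zero.2 (sub_ne_zero.2 hαγ)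
  have e : kernel z z α γ = (deriv z α / (z α - z γ)).im +
      (deriv z α * (halfCot (z α - z γ) - 1 / (z α - z γ))).im := by
    rw [kernel, ← Complex.add_im]
    congr 1
    ring
  rw [e, im_deriv_div_sub hαγ hD, Function.comp_apply, Complex.add_im]
  congr 2
  simp only [Pi.div_apply]
  generalize z α - z γ = D at *
  generalize ((α - γ : ℝ) : ℂ) = b at *
  field_simp
  ring

end OneCurve

/-! ### The kernels on the circle -/

theorem exists_abs_le_pi_coe_eq (t : AddCircle (2 * π)) :
    ∃ b : ℝ, (b : AddCircle (2 * π)) = t ∧ |b| ≤ π ∧ ‖t‖ = |b| := by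
  obtain ⟨r, rfl⟩ := QuotientAddGroup.mk_surjective t
  have h1 := AddCircle.norm_eq (p := 2 * π) (x := r)
  have h2 := AddCircle.norm_le_half_period (2 * π) (x := (r : AddCircle (2 * π)))
    Real.two_pi_pos.ne'
  refine ⟨r - round ((2 * π)⁻¹ * r) * (2 * π), ?_, ?_, h1⟩
  · have h3 : ((round ((2 * π)⁻¹ * r) * (2 * π) : ℝ) : AddCircle (2 * π)) = 0 :=
      (AddCircle.coe_eq_zero_iff _).2 ⟨round ((2 * π)⁻¹ * r), by simp⟩
    change ((r : AddCircle (2 * π)) - ((round ((2 * π)⁻¹ * r) * (2 * π) : ℝ) : AddCircle (2 * π)))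
      = _
    rw [h3, sub_zero]
  · rw [← h1]
    refine h2.trans (le_of_eq ?_)
    rw [abs_of_pos Real.two_pi_pos]
    ring

/-- The weight `1 + ‖t‖^(δ - 1)` dominating the kernels. -/
noncomputable def weight (δ : ℝ) (t : AddCircle (2 * π)) : ℝ := 1 + ‖t‖ ^ (δ - 1)

theorem measurable_weight (δ : ℝ) : Measurable (weight δ) :=
  measurable_const.add (measurable_norm.pow_const _)

theorem weight_pos (δ : ℝ) (t : AddCircle (2 * π)) : 0 < weight δ t := by
  unfold weight
  positivity

theorem integrable_weight {δ : ℝ} (hδ : 0 < δ) : Integrable (weight δ) := by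
  have hπ := Real.pi_pos
  rw [← (AddCircle.measurePreserving_mk (2 * π) (-π)).integrable_comp
    (measurable_weight δ).aestronglyMeasurable]
  have hle : -π ≤ -π + 2 * π := by linarith
  change IntegrableOn _ _ _
  rw [← intervalIntegrable_iff_integrableOn_Ioc_of_le hle]
  have e : -π + 2 * π = π := by ring
  rw [e]
  have h1 : IntervalIntegrable (fun t : ℝ => |t| ^ (δ - 1)) volume 0 π := by
    refine (intervalIntegral.intervalIntegrable_rpow' (r := δ - 1) (by linarith)).congr ?_
    intro t ht
    rw [Set.uIoc_of_le hπ.le] at ht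
    simp only [abs_of_pos ht.1]
  have h2 : IntervalIntegrable (fun t : ℝ => |t| ^ (δ - 1)) volume (-π) 0 := by
    rw [IntervalIntegrable.iff_comp_neg]
    simp only [abs_neg, neg_neg, neg_zero]
    exact h1.symm
  refine (intervalIntegrable_const (c := (1 : ℝ))).add (h2.trans h1) |>.congr ?_
  intro t ht
  rw [Set.uIoc_of_le (by linarith)] at ht
  have hn : ‖(t : AddCircle (2 * π))‖ = |t| := by
    rw [AddCircle.norm_coe_eq_abs_iff _ Real.two_pi_pos.ne', abs_of_pos Real.two_pi_pos, abs_le]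
    constructor <;> linarith [ht.1, ht.2]
  change 1 + |t| ^ (δ - 1) = weight δ t
  rw [weight, hn]

/-- The function on the torus induced by a doubly periodic function on the plane. -/
noncomputable def torusLift (K : ℝ → ℝ → ℝ) (a c : AddCircle (2 * π)) : ℝ := K a.out c.out

/-! ### Descending doubly periodic functions to the torus. -/

section Lift

variable {K : ℝ → ℝ → ℝ}

theorem torusLift_coe (h₁ : ∀ γ, Function.Periodic (fun α => K α γ) (2 * π))
    (h₂ : ∀ α, Function.Periodic (K α) (2 * π)) (α γ : ℝ) : torusLift K α γ = K α γ := by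
  have hout {f : ℝ → ℝ} (hf : Function.Periodic f (2 * π)) (t : ℝ) :
      f (t : AddCircle (2 * π)).out = f t := by
    rw [← hf.lift_coe, ← hf.lift_coe, QuotientAddGroup.out_eq']
  rw [torusLift, hout (h₂ _)]
  exact hout (h₁ γ) α

/-- The product of the covering maps is an open quotient map, so continuity at a point descends. -/
theorem continuousAt_torusLift (h₁ : ∀ γ, Function.Periodic (fun α => K α γ) (2 * π))
    (h₂ : ∀ α, Function.Periodic (K α) (2 * π)) {α γ : ℝ}
    (h : ContinuousAt (fun p : ℝ × ℝ => K p.1 p.2) (α, γ)) :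
    ContinuousAt (Function.uncurry (torusLift K))
      ((α : AddCircle (2 * π)), (γ : AddCircle (2 * π))) := by
  have hq : IsOpenQuotientMap (Prod.map (fun t : ℝ => (t : AddCircle (2 * π)))
      (fun t : ℝ => (t : AddCircle (2 * π)))) :=
    QuotientAddGroup.isOpenQuotientMap_mk.prodMap QuotientAddGroup.isOpenQuotientMap_mk
  have := hq.continuousAt_comp_iff (g := Function.uncurry (torusLift K)) (x := (α, γ))
  refine this.1 ?_
  have e : Function.uncurry (torusLift K) ∘ Prod.map (fun t : ℝ => (t : AddCircle (2 * π)))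
      (fun t : ℝ => (t : AddCircle (2 * π))) = fun p : ℝ × ℝ => K p.1 p.2 := by
    funext p
    exact torusLift_coe h₁ h₂ p.1 p.2
  rw [e]
  exact h

/-- The kernel may be discontinuous at the diagonal, which is closed, so it is glued from a piece
continuous on the diagonal and one continuous off it. -/
theorem measurable_uncurry_of_continuousAt {k : AddCircle (2 * π) → AddCircle (2 * π) → ℝ}
    (hk : ∀ p : AddCircle (2 * π) × AddCircle (2 * π), p.1 ≠ p.2 →
      ContinuousAt (Function.uncurry k) p)
    (hd : Continuous fun a => k a a) : Measurable (Function.uncurry k) := by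
  classical
  have hs : MeasurableSet {p : AddCircle (2 * π) × AddCircle (2 * π) | p.1 = p.2} :=
    (isClosed_eq continuous_fst continuous_snd).measurableSet
  have e : Function.uncurry k = Set.piecewise
      {p : AddCircle (2 * π) × AddCircle (2 * π) | p.1 = p.2} (fun p => k p.1 p.1)
      (Function.uncurry k) := by
    funext p
    by_cases hp : p ∈ {p : AddCircle (2 * π) × AddCircle (2 * π) | p.1 = p.2}
    · rw [Set.piecewise_eq_of_mem _ _ _ hp, Function.uncurry]
      exact congrArg (k p.1) (Eq.symm hp)
    · rw [Set.piecewise_eq_of_notMem _ _ _ hp]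
  rw [e]
  exact ContinuousOn.measurable_piecewise (hd.comp continuous_fst).continuousOn
    (fun p hp => (hk p hp).continuousWithinAt) hs

end Lift

/-- The line is a countable union of periods, each carried to the circle preserving measure. -/
theorem ae_coe_of_ae {P : AddCircle (2 * π) → Prop} (h : ∀ᵐ a, P a) :
    ∀ᵐ α : ℝ, P (α : AddCircle (2 * π)) := by
  rw [← Measure.restrict_univ (μ := (volume : Measure ℝ)),
    ← iUnion_Ioc_add_zsmul Real.two_pi_pos 0, ae_restrict_iUnion_iff]
  intro n
  have h1 := (AddCircle.measurePreserving_mk (2 * π) (0 + n • (2 * π))).quasiMeasurePreserving.ae h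
  rwa [add_assoc, ← add_one_zsmul] at h1

theorem integral_circle_eq (α : ℝ) (f : AddCircle (2 * π) → ℝ) :
    ∫ c, f c = ∫ β in (-π)..π, f ((α - β : ℝ) : AddCircle (2 * π)) := by
  rw [intervalIntegral.integral_comp_sub_left (fun γ : ℝ => f (γ : AddCircle (2 * π))) α,
    ← AddCircle.intervalIntegral_preimage (2 * π) (α - π) f]
  congr 1
  ring

/-- Sufficient conditions on a pair of curves for the tangential Birkhoff–Rott operator to be
compact from `L²` to `H¹`. -/
structure IsAdmissiblePair (δ : ℝ) (x y : ℝ → ℂ) (N M : ℝ) : Prop where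
  curve : IsCurveBound δ x N
  continuous_right : Continuous y
  periodic_right : ∀ α, y (α + 2 * π) = y α + 2 * π
  sin_ne_zero : ∀ α γ : ℝ, (α : AddCircle (2 * π)) ≠ γ → Complex.sin ((x α - y γ) / 2) ≠ 0
  kernel_le : ∀ α γ : ℝ, |α - γ| ≤ π → |kernel x y α γ| ≤ M
  kernelDeriv_le : ∀ α γ : ℝ, |α - γ| ≤ π →
    |kernelDeriv x y α γ| ≤ M * (1 + |α - γ| ^ (δ - 1))
  continuous_diag : Continuous fun α => kernel x y α α
  continuous_diag_deriv : Continuous fun α => kernelDeriv x y α α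
  exists_limit : ∀ γ, ∃ l, Tendsto (fun α => kernel x y α γ) (𝓝[≠] γ) (𝓝 l)
  exists_lower : ∀ α, ∃ c > 0, ∀ β, c * |β| ≤ ‖x α - y (α - β)‖
  exists_upper : ∀ α, ∃ B, ∀ β, |(deriv x α / (x α - y (α - β))).im| ≤ B

namespace IsAdmissiblePair

variable {δ : ℝ} {x y : ℝ → ℂ} {N M : ℝ}

theorem hasPV (h : IsAdmissiblePair δ x y N M) (u : L2) (α : ℝ) :
    HasPV (tangentialIntegrand y x u α)
      (∫ β in (-π)..π, kernel x y α (α - β) * u ((α - β : ℝ) : AddCircle (2 * π))) := by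
  obtain ⟨c, hc, hlow⟩ := h.exists_lower α
  obtain ⟨B, hB⟩ := h.exists_upper α
  exact hasPV_tangentialIntegrand h.continuous_right h.periodic_right hc hlow hB u

theorem periodic_left (h : IsAdmissiblePair δ x y N M) (γ : ℝ) :
    Function.Periodic (fun α => kernel x y α γ) (2 * π) ∧
      Function.Periodic (fun α => kernelDeriv x y α γ) (2 * π) := by
  have e (α : ℝ) : x (α + 2 * π) - y γ = x α - y γ + 2 * π := by rw [h.curve.periodic]; ring
  constructor <;> intro α
  · simp only [kernel, e, halfCot_add_two_pi, h.curve.deriv_periodic α]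
  · simp only [kernelDeriv, e, halfCot_add_two_pi, halfCotDeriv_add_two_pi,
      h.curve.deriv_periodic α, h.curve.deriv_deriv_periodic α]

theorem periodic_kernel_right (h : IsAdmissiblePair δ x y N M) (α : ℝ) :
    Function.Periodic (kernel x y α) (2 * π) ∧ Function.Periodic (kernelDeriv x y α) (2 * π) := by
  have e (γ : ℝ) : x α - y γ = x α - y (γ + 2 * π) + 2 * π := by rw [h.periodic_right]; ring
  constructor <;> intro γ
  · simp only [kernel]
    rw [e γ, halfCot_add_two_pi]
  · simp only [kernelDeriv]
    rw [e γ, halfCot_add_two_pi, halfCotDeriv_add_two_pi]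

theorem torusLift_kernel_coe (h : IsAdmissiblePair δ x y N M) (α γ : ℝ) :
    torusLift (kernel x y) α γ = kernel x y α γ :=
  torusLift_coe (fun γ => (h.periodic_left γ).1) (fun α => (h.periodic_kernel_right α).1) α γ

theorem torusLift_kernelDeriv_coe (h : IsAdmissiblePair δ x y N M) (α γ : ℝ) :
    torusLift (kernelDeriv x y) α γ = kernelDeriv x y α γ :=
  torusLift_coe (fun γ => (h.periodic_left γ).2) (fun α => (h.periodic_kernel_right α).2) α γ

theorem continuousAt_off_diag (h : IsAdmissiblePair δ x y N M)
    (p : AddCircle (2 * π) × AddCircle (2 * π)) (hp : p.1 ≠ p.2) :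
    ContinuousAt (Function.uncurry (torusLift (kernel x y))) p ∧
      ContinuousAt (Function.uncurry (torusLift (kernelDeriv x y))) p := by
  obtain ⟨a, c⟩ := p
  obtain ⟨α, rfl⟩ := QuotientAddGroup.mk_surjective a
  obtain ⟨γ, rfl⟩ := QuotientAddGroup.mk_surjective c
  have hc := continuousAt_kernel h.curve h.continuous_right (p := (α, γ)) (h.sin_ne_zero α γ hp)
  exact ⟨continuousAt_torusLift (fun γ => (h.periodic_left γ).1)
      (fun α => (h.periodic_kernel_right α).1) hc.1,
    continuousAt_torusLift (fun γ => (h.periodic_left γ).2)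
      (fun α => (h.periodic_kernel_right α).2) hc.2⟩

theorem continuous_torusLift_diag {K : ℝ → ℝ → ℝ}
    (hK : ∀ α γ : ℝ, torusLift K α γ = K α γ) (hc : Continuous fun α => K α α) :
    Continuous fun a => torusLift K a a := by
  rw [← QuotientAddGroup.isOpenQuotientMap_mk.continuous_comp_iff]
  exact hc.congr fun α => (hK α α).symm

/-- Every pair on the circle has lifts at most `π` apart, and for these `|α - γ|` is the circle
distance; bounds near the diagonal of the plane therefore suffice. -/
theorem isDominatedKernel_of_bound {K : ℝ → ℝ → ℝ} (hδ : 0 < δ)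
    (hK : ∀ α γ : ℝ, torusLift K α γ = K α γ)
    (hm : Measurable (Function.uncurry (torusLift K)))
    (hb : ∀ α γ : ℝ, |α - γ| ≤ π → |K α γ| ≤ M * (1 + |α - γ| ^ (δ - 1))) :
    IsDominatedKernel (torusLift K) (fun t => M * weight δ t) where
  measurable := hm
  bound := fun a c => by
    obtain ⟨γ, rfl⟩ := QuotientAddGroup.mk_surjective c
    obtain ⟨b, hb1, hb2, hb3⟩ := exists_abs_le_pi_coe_eq (a - (γ : AddCircle (2 * π)))
    have ha : a = ((γ + b : ℝ) : AddCircle (2 * π)) := by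
      rw [AddCircle.coe_add, hb1, add_sub_cancel]
    have h1 := hb (γ + b) γ (by rwa [add_sub_cancel_left])
    rw [add_sub_cancel_left, ← hb3] at h1
    rw [ha] at h1 ⊢
    refine le_trans (le_of_eq ?_) h1
    exact congrArg _ (hK _ _)
  measurable_weight := (measurable_weight δ).const_mul M
  integrable := (integrable_weight hδ).const_mul M

/-- The periodized principal value is `π` times the operator sought. The factor `2` comes from
bounding the function and its derivative separately. -/
theorem exists_operator (h : IsAdmissiblePair δ x y N M) (hδ : 0 < δ) :
    ∃ T : L2 →L[ℝ] H1, IsCompactOperator T ∧ ‖T‖ ≤ 2 / π * (∫ t, weight δ t) * M ∧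
      ∀ u, ∀ᵐ α : ℝ, H1.toL2 (T u) (α : AddCircle (2 * π)) = tangentialBR y x u α := by
  have hπ := Real.pi_pos
  have hM : 0 ≤ M := (abs_nonneg _).trans (h.kernel_le 0 0 (by simpa using hπ.le))
  have hkc := fun p hp => (h.continuousAt_off_diag p hp).1
  have hlc := fun p hp => (h.continuousAt_off_diag p hp).2
  have hk : IsDominatedKernel (torusLift (kernel x y)) (fun t => M * weight δ t) := by
    refine isDominatedKernel_of_bound hδ h.torusLift_kernel_coe
      (measurable_uncurry_of_continuousAt hkc
        (continuous_torusLift_diag h.torusLift_kernel_coe h.continuous_diag))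
      fun α γ hαγ => (h.kernel_le α γ hαγ).trans ?_
    refine le_mul_of_one_le_right hM ?_
    have : 0 ≤ |α - γ| ^ (δ - 1) := by positivity
    linarith
  have hl : IsDominatedKernel (torusLift (kernelDeriv x y)) (fun t => M * weight δ t) :=
    isDominatedKernel_of_bound hδ h.torusLift_kernelDeriv_coe
      (measurable_uncurry_of_continuousAt hlc
        (continuous_torusLift_diag h.torusLift_kernelDeriv_coe h.continuous_diag_deriv))
      h.kernelDeriv_le
  have hkl : IsKernelDeriv (torusLift (kernel x y)) (torusLift (kernelDeriv x y)) := by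
    refine ⟨fun c t ht => ?_, fun c => ?_⟩
    · obtain ⟨γ, rfl⟩ := QuotientAddGroup.mk_surjective c
      have h1 := hasDerivAt_kernel h.curve (h.sin_ne_zero t γ ht)
      have e : (fun s : ℝ => torusLift (kernel x y) s (γ : AddCircle (2 * π))) =
          fun s => kernel x y s γ := funext fun s => h.torusLift_kernel_coe s γ
      rw [← h.torusLift_kernelDeriv_coe, ← e] at h1
      exact h1
    · obtain ⟨γ, rfl⟩ := QuotientAddGroup.mk_surjective c
      obtain ⟨l, hlim⟩ := h.exists_limit γ
      -- The covering map is open, so neighbourhoods on the circle are images of those on the line,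
      -- and a point whose image differs from that of `γ` differs from `γ`.
      refine ⟨l, fun S hS => ?_⟩
      have h1 : ∀ᶠ s in 𝓝[≠] γ, kernel x y s γ ∈ S := hlim hS
      rw [eventually_nhdsWithin_iff] at h1
      change ∀ᶠ a in 𝓝[≠] (γ : AddCircle (2 * π)), torusLift (kernel x y) a γ ∈ S
      rw [eventually_nhdsWithin_iff]
      have h2 : 𝓝 (γ : AddCircle (2 * π)) = map (fun t : ℝ => (t : AddCircle (2 * π))) (𝓝 γ) :=
        (QuotientAddGroup.isOpenQuotientMap_mk.map_nhds_eq γ).symm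
      rw [h2, eventually_map]
      filter_upwards [h1] with s hs hne
      rw [h.torusLift_kernel_coe]
      exact hs fun hsγ => hne (congrArg _ hsγ)
  obtain ⟨T, hTc, hTn, hTu⟩ := hk.exists_H1_operator hl hkc hlc hkl
  refine ⟨(1 / π : ℝ) • T, hTc.smul (1 / π : ℝ), ?_, fun u => ?_⟩
  · have hI : 0 ≤ ∫ t, weight δ t := integral_nonneg fun t => (weight_pos _ t).le
    rw [integral_const_mul] at hTn
    refine ContinuousLinearMap.opNorm_le_bound _ (by positivity) fun u => ?_
    change ‖(1 / π : ℝ) • ((T u : H1) : WithLp 2 (L2 × L2))‖ ≤ _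
    rw [norm_smul, Real.norm_of_nonneg (by positivity)]
    calc 1 / π * ‖((T u : H1) : WithLp 2 (L2 × L2))‖
        ≤ 1 / π * (2 * (M * ∫ t, weight δ t) * ‖u‖) := by
          gcongr
          exact T.le_of_opNorm_le hTn u
      _ = _ := by ring
  · have h1 : H1.toL2 (((1 / π : ℝ) • T) u) =ᵐ[volume] fun a => (1 / π) *
        ∫ c, torusLift (kernel x y) a c * u c := by
      have e : H1.toL2 (((1 / π : ℝ) • T) u) = (1 / π : ℝ) • H1.toL2 (T u) := rfl
      rw [e]
      filter_upwards [Lp.coeFn_smul (1 / π : ℝ) (H1.toL2 (T u)), hTu u] with a h2 h3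
      rw [h2, Pi.smul_apply, h3, smul_eq_mul]
    filter_upwards [ae_coe_of_ae h1] with α hα
    rw [hα, tangentialBR, (h.hasPV u α).pv_eq, integral_circle_eq α]
    congr 1
    refine intervalIntegral.integral_congr fun β _ => ?_
    simp only [h.torusLift_kernel_coe]

end IsAdmissiblePair

theorem isAdmissiblePair_self {δ : ℝ} {z : ℝ → ℂ} {N s : ℝ} (hz : IsCurveBound δ z N)
    (hδ : 0 < δ) (hs : 1 ≤ s) (harc : ∀ α γ, |α - γ| ≤ s * ‖z α - z γ‖) :
    IsAdmissiblePair δ z z N (9 * s ^ 2 * N ^ 2) := by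
  have hs0 : 0 < s := by linarith
  -- Division by zero in the cotangent assigns `0` on the diagonal. The value is immaterial for the
  -- integrals; it only serves measurability and the pointwise bounds.
  have hk0 (α : ℝ) : kernel z z α α = 0 := by
    simp [kernel, halfCot, Complex.cot_eq_cos_div_sin]
  have hl0 (α : ℝ) : kernelDeriv z z α α = 0 := by
    simp [kernelDeriv, halfCot, halfCotDeriv, Complex.cot_eq_cos_div_sin]
  refine
    { curve := hz
      continuous_right := hz.continuous
      periodic_right := hz.periodic
      sin_ne_zero := fun α γ hαγ => sin_ne_zero_of_separated hz.periodic fun m hm => ?_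
      kernel_le := fun α γ hαγ => ?_
      kernelDeriv_le := fun α γ hαγ => ?_
      continuous_diag := by simp only [hk0]; exact continuous_const
      continuous_diag_deriv := by simp only [hl0]; exact continuous_const
      exists_limit := tendsto_kernel_self hz hδ harc
      exists_lower := fun α => ⟨1 / s, by positivity, fun β => ?_⟩
      exists_upper := fun α => ⟨N * s, fun β => abs_im_deriv_div_sub_le hz harc hs0.le _ _⟩ }
  -- The arc-chord condition makes the curve injective on all of `ℝ`, so meeting a translate forces
  -- equal classes.
  · have h1 : α = γ + 2 * π * m := by
      by_contra hne
      exact ne_of_arcChord harc hne (sub_eq_zero.2 hm)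
    refine hαγ ?_
    have h3 : ((2 * π * m : ℝ) : AddCircle (2 * π)) = 0 :=
      (AddCircle.coe_eq_zero_iff _).2 ⟨m, by simp [mul_comm]⟩
    rw [h1, AddCircle.coe_add, h3, add_zero]
  · rcases eq_or_ne α γ with rfl | hne
    · rw [hk0, abs_zero]; positivity
    · exact (abs_kernel_self_le hz hδ harc hs hαγ hne).1
  · rcases eq_or_ne α γ with rfl | hne
    · rw [hl0, abs_zero]; positivity
    · exact (abs_kernel_self_le hz hδ harc hs hαγ hne).2
  · have := harc α (α - β)
    rw [sub_sub_cancel] at this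
    rw [div_mul_eq_mul_div, one_mul, div_le_iff₀ hs0, mul_comm]
    exact this

theorem isAdmissiblePair_of_separated {δ : ℝ} {x y : ℝ → ℂ} {N N' s : ℝ}
    (hx : IsCurveBound δ x N) (hy : IsCurveBound δ y N') (hs : 1 ≤ s)
    (hsep : ∀ α γ, 1 ≤ s * ‖x α - y γ‖) :
    IsAdmissiblePair δ x y N (9 * s ^ 2 * N ^ 2) := by
  have hs0 : 0 < s := by linarith
  have hne (α γ : ℝ) : x α ≠ y γ := by
    intro h
    have := hsep α γ
    rw [h, sub_self, norm_zero, mul_zero] at this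
    linarith
  have hsin (α γ : ℝ) : Complex.sin ((x α - y γ) / 2) ≠ 0 :=
    sin_ne_zero_of_separated hy.periodic fun m => hne _ _
  have hc (p : ℝ × ℝ) := continuousAt_kernel hx hy.continuous (hsin p.1 p.2)
  have hbd := abs_kernel_le hx hy.periodic hs hsep
  have hdiag : Continuous fun α : ℝ => (α, α) := continuous_id.prodMk continuous_id
  refine
    { curve := hx
      continuous_right := hy.continuous
      periodic_right := hy.periodic
      sin_ne_zero := fun α γ _ => hsin α γ
      kernel_le := fun α γ _ => (hbd α γ).1
      kernelDeriv_le := fun α γ _ => (hbd α γ).2.trans (le_mul_of_one_le_right ?_ ?_)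
      continuous_diag := (continuous_iff_continuousAt.2 fun p => (hc p).1).comp hdiag
      continuous_diag_deriv := (continuous_iff_continuousAt.2 fun p => (hc p).2).comp hdiag
      exists_limit := fun γ => ⟨kernel x y γ γ,
        (hasDerivAt_kernel hx (hsin γ γ)).continuousAt.tendsto.mono_left nhdsWithin_le_nhds⟩
      exists_lower := fun α => ?_
      exists_upper := fun α => ⟨N * s, fun β => ?_⟩ }
  · positivity
  · have : 0 ≤ |α - γ| ^ (δ - 1) := by positivity
    linarith
  · have hper : Function.Periodic (fun t : ℝ => y t - (t : ℂ)) (2 * π) := by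
      intro t
      simp only [hy.periodic]
      push_cast
      ring
    obtain ⟨P, hP⟩ := (hper.isBounded_of_continuous Real.two_pi_pos.ne'
      (hy.continuous.sub Complex.continuous_ofReal)).exists_norm_le
    have hP' (t : ℝ) : ‖y t - (t : ℂ)‖ ≤ P := hP _ ⟨t, rfl⟩
    have hP0 : 0 ≤ P := (norm_nonneg _).trans (hP' 0)
    set A : ℝ := ‖x α - (α : ℂ)‖ + P with hA
    have hA0 : 0 ≤ A := by positivity
    -- Boundedness of `y(t) - t` gives `|β| ≤ |w| + A`, and separation `1 ≤ s|w|` turns `A` into `A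
    -- s |w|`.
    refine ⟨1 / (1 + A * s), by positivity, fun β => ?_⟩
    have e : (β : ℂ) = (x α - y (α - β)) - (x α - (α : ℂ)) +
        (y (α - β) - ((α - β : ℝ) : ℂ)) := by push_cast; ring
    have h1 : |β| ≤ ‖x α - y (α - β)‖ + A := by
      rw [← Real.norm_eq_abs, ← Complex.norm_real, e]
      refine (norm_add_le _ _).trans ?_
      have := norm_sub_le (x α - y (α - β)) (x α - (α : ℂ))
      have := hP' (α - β)
      linarith
    rw [div_mul_eq_mul_div, one_mul, div_le_iff₀ (by positivity)]
    have h2 := mul_le_mul_of_nonneg_left (hsep α (α - β)) hA0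
    linarith
  · refine (Complex.abs_im_le_norm _).trans ?_
    have h1 := hsep α (α - β)
    have h2 : 0 < ‖x α - y (α - β)‖ := norm_pos_iff.2 (sub_ne_zero.2 (hne _ _))
    have hN0 := hx.nonneg
    rw [norm_div, div_le_iff₀ h2]
    calc ‖deriv x α‖ ≤ N * 1 := by rw [mul_one]; exact hx.norm_deriv_le α
      _ ≤ N * (s * ‖x α - y (α - β)‖) := by gcongr
      _ = _ := by ring

/-! ### Arc-chord and distance functions -/

theorem abs_sub_le_of_arcChordNorm {z : ℝ → ℂ} (hF : arcChordNorm z < ⊤) (α γ : ℝ) :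
    |α - γ| ≤ √(arcChordNorm z).toReal * ‖z α - z γ‖ := by
  rcases eq_or_ne α γ with rfl | hne
  · simp
  have hb : α - γ ≠ 0 := sub_ne_zero.2 hne
  have h1 : arcChord z α (α - γ) ≤ arcChordNorm z :=
    (le_iSup (fun β => arcChord z α β) (α - γ)).trans
      (le_iSup (fun α => ⨆ β, arcChord z α β) α)
  rw [arcChord, if_neg hb, sub_sub_cancel, ENNReal.div_le_iff_le_mul (Or.inr hF.ne)
    (Or.inl (by simp))] at h1
  have h2 := ENNReal.toReal_mono (ENNReal.mul_ne_top hF.ne (by simp)) h1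
  rw [ENNReal.toReal_mul, ENNReal.toReal_pow, ENNReal.toReal_pow, toReal_enorm, toReal_enorm,
    Real.norm_eq_abs] at h2
  refine abs_le_of_sq_le_sq' (a := |α - γ|) ?_ (by positivity) |>.2
  rwa [mul_pow, Real.sq_sqrt ENNReal.toReal_nonneg]

/-- Parameters `2π` apart have chord exactly `2π`, where the arc-chord quotient is `1`. -/
theorem one_le_arcChordNorm {z : ℝ → ℂ} (hz : ∀ α, z (α + 2 * π) = z α + 2 * π)
    (hF : arcChordNorm z < ⊤) : 1 ≤ (arcChordNorm z).toReal := by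
  have h1 := abs_sub_le_of_arcChordNorm hF (0 + 2 * π) 0
  rw [hz, add_sub_cancel_left, add_sub_cancel_left] at h1
  have e : ‖(2 * π : ℂ)‖ = 2 * π := by
    rw [norm_mul, Complex.norm_two, Complex.norm_real, Real.norm_of_nonneg Real.pi_pos.le]
  rw [e, abs_of_pos Real.two_pi_pos] at h1
  have h2 : 1 ≤ √(arcChordNorm z).toReal := by nlinarith [Real.two_pi_pos]
  exact Real.one_le_sqrt.1 h2

theorem one_le_mul_norm_sub_of_distNorm {z h : ℝ → ℂ} (hd : distNorm z h < ⊤) (α γ : ℝ) :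
    1 ≤ √(max 1 (distNorm z h).toReal) * ‖z α - h γ‖ := by
  have h1 : (‖z α - h (α - (α - γ))‖ₑ ^ 2)⁻¹ ≤ distNorm z h :=
    (le_iSup (fun β => (‖z α - h (α - β)‖ₑ ^ 2)⁻¹) (α - γ)).trans
      (le_iSup (fun α => ⨆ β, (‖z α - h (α - β)‖ₑ ^ 2)⁻¹) α)
  rw [sub_sub_cancel, ← one_div, ENNReal.div_le_iff_le_mul (Or.inr hd.ne)
    (Or.inl (by simp))] at h1
  have h2 := ENNReal.toReal_mono (ENNReal.mul_ne_top hd.ne (by simp)) h1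
  rw [ENNReal.toReal_mul, ENNReal.toReal_pow, toReal_enorm, ENNReal.toReal_one] at h2
  have h3 : (1 : ℝ) ^ 2 ≤ (√(max 1 (distNorm z h).toReal) * ‖z α - h γ‖) ^ 2 := by
    rw [mul_pow, Real.sq_sqrt (zero_le_one.trans (le_max_left _ _)), one_pow]
    refine h2.trans ?_
    gcongr
    exact le_max_right _ _
  exact abs_le_of_sq_le_sq' h3 (by positivity) |>.2

/-! ### The matrix operator -/

theorem exists_matrix_operator (A B C D : L2 →L[ℝ] H1) (hA : IsCompactOperator A)
    (hB : IsCompactOperator B) (hC : IsCompactOperator C) (hD : IsCompactOperator D) :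
    ∃ S : L2Pair →L[ℝ] H1Pair, IsCompactOperator S ∧ ‖S‖ ≤ ‖A‖ + ‖B‖ + ‖C‖ + ‖D‖ ∧
      ∀ w : L2Pair, S w = WithLp.toLp 1 (A w.fst + B w.snd, C w.fst + D w.snd) := by
  let e : H1 × H1 →L[ℝ] H1Pair := (WithLp.prodContinuousLinearEquiv 1 ℝ H1 H1).symm
  let f : L2Pair →L[ℝ] L2 × L2 := WithLp.prodContinuousLinearEquiv 1 ℝ L2 L2
  let π₁ : L2Pair →L[ℝ] L2 := (ContinuousLinearMap.fst ℝ L2 L2).comp f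
  let π₂ : L2Pair →L[ℝ] L2 := (ContinuousLinearMap.snd ℝ L2 L2).comp f
  let i₁ : H1 →L[ℝ] H1Pair := e.comp (ContinuousLinearMap.inl ℝ H1 H1)
  let i₂ : H1 →L[ℝ] H1Pair := e.comp (ContinuousLinearMap.inr ℝ H1 H1)
  let S : L2Pair →L[ℝ] H1Pair :=
    i₁.comp (A.comp π₁ + B.comp π₂) + i₂.comp (C.comp π₁ + D.comp π₂)
  have hS (w : L2Pair) : S w = WithLp.toLp 1 (A w.fst + B w.snd, C w.fst + D w.snd) := by
    change WithLp.toLp 1 (A w.fst + B w.snd, (0 : H1)) +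
      WithLp.toLp 1 ((0 : H1), C w.fst + D w.snd) = _
    rw [← WithLp.toLp_add, Prod.mk_add_mk, add_zero, zero_add]
  refine ⟨S, ?_, ?_, hS⟩
  · have h1 : IsCompactOperator (A.comp π₁ + B.comp π₂ : L2Pair →L[ℝ] H1) :=
      (hA.comp_clm π₁).add (hB.comp_clm π₂)
    have h2 : IsCompactOperator (C.comp π₁ + D.comp π₂ : L2Pair →L[ℝ] H1) :=
      (hC.comp_clm π₁).add (hD.comp_clm π₂)
    exact (h1.clm_comp i₁).add (h2.clm_comp i₂)
  · refine S.opNorm_le_bound (by positivity) fun w => ?_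
    -- In the sum norms, each entry of the matrix contributes at most its operator norm.
    rw [hS, WithLp.prod_norm_eq_of_L1, WithLp.prod_norm_eq_of_L1]
    change ‖A w.fst + B w.snd‖ + ‖C w.fst + D w.snd‖ ≤ _ * (‖w.fst‖ + ‖w.snd‖)
    have h1 := norm_add_le (A w.fst) (B w.snd)
    have h2 := norm_add_le (C w.fst) (D w.snd)
    have hA' := A.le_opNorm w.fst
    have hB' := B.le_opNorm w.snd
    have hC' := C.le_opNorm w.fst
    have hD' := D.le_opNorm w.snd
    have p1 : 0 ≤ ‖A‖ * ‖w.snd‖ := by positivity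
    have p2 : 0 ≤ ‖B‖ * ‖w.fst‖ := by positivity
    have p3 : 0 ≤ ‖C‖ * ‖w.snd‖ := by positivity
    have p4 : 0 ≤ ‖D‖ * ‖w.fst‖ := by positivity
    nlinarith

theorem ae_toL2_add (f g : H1) :
    ∀ᵐ α : ℝ, H1.toL2 (f + g) (α : AddCircle (2 * π)) = H1.toL2 f α + H1.toL2 g α :=
  ae_coe_of_ae (Lp.coeFn_add (H1.toL2 f) (H1.toL2 g))

/-- All four contributions are absorbed into `Q = F² D² N⁴`, using that each factor is at least `1`.
The final `+ 1` makes the constant strictly positive. -/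
theorem norm_estimate {F D N W H G t : ℝ} (hF : 1 ≤ F) (hD : 1 ≤ D) (hN : 1 ≤ N) (hW : 0 ≤ W)
    (hG : 0 ≤ G) (ht : t ≤ W * (9 * F * N ^ 2) + W * (9 * D * N ^ 2) + W * (9 * D * H ^ 2) +
      W * (9 * G * H ^ 2)) :
    t ≤ (9 * W * (2 + H ^ 2 + G * H ^ 2) + 1) * F ^ 2 * D ^ 2 * N ^ 4 := by
  have hF2 : F ≤ F ^ 2 := by nlinarith
  have hD2 : D ≤ D ^ 2 := by nlinarith
  have hF21 : 1 ≤ F ^ 2 := one_le_pow₀ hF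
  have hD21 : 1 ≤ D ^ 2 := one_le_pow₀ hD
  have hN24 : N ^ 2 ≤ N ^ 4 := pow_le_pow_right₀ hN (by norm_num)
  have hN41 : 1 ≤ N ^ 4 := one_le_pow₀ hN
  have q1 : F * 1 * N ^ 2 ≤ F ^ 2 * D ^ 2 * N ^ 4 := by gcongr
  have q2 : 1 * D * N ^ 2 ≤ F ^ 2 * D ^ 2 * N ^ 4 := by gcongr
  have q3 : 1 * D * 1 ≤ F ^ 2 * D ^ 2 * N ^ 4 := by gcongr
  rw [mul_assoc _ (F ^ 2), mul_assoc _ (F ^ 2 * D ^ 2)]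
  generalize F ^ 2 * D ^ 2 * N ^ 4 = Q at *
  have q4 : 1 ≤ Q := by linarith
  calc t ≤ 9 * W * (F * 1 * N ^ 2 + 1 * D * N ^ 2 + 1 * D * 1 * H ^ 2 + 1 * (G * H ^ 2)) :=
        ht.trans_eq (by ring)
    _ ≤ 9 * W * (Q + Q + Q * H ^ 2 + Q * (G * H ^ 2)) := by gcongr
    _ = 9 * W * (2 + H ^ 2 + G * H ^ 2) * Q := by ring
    _ ≤ (9 * W * (2 + H ^ 2 + G * H ^ 2) + 1) * Q := by
        gcongr
        linarith

end BirkhoffRott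

theorem mainTheorem5 (δ : ℝ≥0) (hδ₀ : 0 < δ) (hδ₁ : δ ≤ 1)
    (h : ℝ → ℂ) (hh : BirkhoffRott.IsC2HolderCurve δ h)
    (hFh : BirkhoffRott.arcChordNorm h < ⊤) :
    ∃ C : ℝ, 0 < C ∧
      ∀ z : ℝ → ℂ, BirkhoffRott.IsC2HolderCurve δ z → BirkhoffRott.arcChordNorm z < ⊤ →
        BirkhoffRott.distNorm z h < ⊤ →
        BirkhoffRott.OperatorsDefined z h ∧
        ∃ S : BirkhoffRott.L2Pair →L[ℝ] BirkhoffRott.H1Pair,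
          BirkhoffRott.IsMatrixOperator z h S ∧ IsCompactOperator S ∧
          ‖S‖ ≤ C * (BirkhoffRott.arcChordNorm z).toReal ^ 2
            * (max 1 (BirkhoffRott.distNorm z h).toReal) ^ 2
            * (BirkhoffRott.c2HolderNorm δ z).toReal ^ 4 := by
  open BirkhoffRott in
  have hδ : (0 : ℝ) < δ := NNReal.coe_pos.2 hδ₀
  have hπ := Real.pi_pos
  have hbh := hh.isCurveBound
  have hFh1 := one_le_arcChordNorm hh.periodic hFh
  set W : ℝ := 2 / π * ∫ t, weight δ t with hW
  have hW0 : 0 ≤ W := mul_nonneg (by positivity) (integral_nonneg fun t => (weight_pos _ t).le)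
  set H : ℝ := (c2HolderNorm δ h).toReal with hH
  set Fh : ℝ := (arcChordNorm h).toReal with hFhdef
  have hpair4 := isAdmissiblePair_self hbh hδ (Real.one_le_sqrt.2 hFh1)
    (abs_sub_le_of_arcChordNorm hFh)
  -- This operator involves only `h`, so its bound can enter the constant before `z` is chosen.
  obtain ⟨T4, hT4c, hT4n, hT4⟩ := hpair4.exists_operator hδ
  rw [Real.sq_sqrt (zero_le_one.trans hFh1)] at hT4n
  refine ⟨9 * W * (2 + H ^ 2 + Fh * H ^ 2) + 1, by positivity, fun z hz hFz hd => ?_⟩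
  have hbz := hz.isCurveBound
  have hFz1 := one_le_arcChordNorm hz.periodic hFz
  set N : ℝ := (c2HolderNorm δ z).toReal with hN
  set F : ℝ := (arcChordNorm z).toReal with hF
  set D : ℝ := max 1 (distNorm z h).toReal with hD
  have hD1 : 1 ≤ D := le_max_left _ _
  have hN1 : 1 ≤ N := hbz.one_le
  have hsep := one_le_mul_norm_sub_of_distNorm hd
  have hpair1 := isAdmissiblePair_self hbz hδ (Real.one_le_sqrt.2 hFz1)
    (abs_sub_le_of_arcChordNorm hFz)
  have hpair2 := isAdmissiblePair_of_separated hbz hbh (Real.one_le_sqrt.2 hD1) hsep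
  -- With the curves exchanged, the norm entering the bound is that of the evaluation curve `h`, so
  -- `z` contributes only through the distance.
  have hpair3 := isAdmissiblePair_of_separated hbh hbz (Real.one_le_sqrt.2 hD1)
    fun α γ => by rw [norm_sub_rev]; exact hsep γ α
  obtain ⟨T1, hT1c, hT1n, hT1⟩ := hpair1.exists_operator hδ
  obtain ⟨T2, hT2c, hT2n, hT2⟩ := hpair2.exists_operator hδ
  obtain ⟨T3, hT3c, hT3n, hT3⟩ := hpair3.exists_operator hδ
  rw [Real.sq_sqrt (zero_le_one.trans hFz1)] at hT1n
  rw [Real.sq_sqrt (zero_le_one.trans hD1)] at hT2n hT3n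
  refine ⟨fun u α => ⟨⟨_, hpair1.hasPV u α⟩, ⟨_, hpair2.hasPV u α⟩, ⟨_, hpair3.hasPV u α⟩,
    ⟨_, hpair4.hasPV u α⟩⟩, ?_⟩
  obtain ⟨S, hSc, hSn, hS⟩ := exists_matrix_operator T1 T2 T3 T4 hT1c hT2c hT3c hT4c
  refine ⟨S, fun w => ?_, hSc, ?_⟩
  · rw [hS]
    filter_upwards [ae_toL2_add (T1 w.fst) (T2 w.snd), ae_toL2_add (T3 w.fst) (T4 w.snd),
      hT1 w.fst, hT2 w.snd, hT3 w.fst, hT4 w.snd] with α a1 a2 b1 b2 b3 b4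
    rw [b1, b2] at a1
    rw [b3, b4] at a2
    exact ⟨a1, a2⟩
  · exact norm_estimate hFz1 hD1 hN1 hW0 (zero_le_one.trans hFh1) (hSn.trans (by gcongr))
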